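/- Let $d,l,s\ge 0$ be integers and let $\mathbb{S}^l$ be the space of real symmetric $l\times l$ matrices with inner product $\operatorname{tr}(AB)$ and the Frobenius norm. Let $f\colon\mathbb{R}^d\to\mathbb{R}$, $G\colon\mathbb{R}^d\to\mathbb{S}^l$ and $h\colon\mathbb{R}^d\to\mathbb{R}^s$ be continuously differentiable, and consider the nonlinear semidefinite program $$(\mathcal{P})\qquad \min_{x\in\mathbb{R}^d} f(x)\quad\text{subject to}\quad G(x)\preceq 0,\ h(x)=0 .$$ Assume that $(\mathcal{P})$ has a globally optimal solution; let $\Omega^*$ be the set of its globally optimal solutions and $f^*$ its optimal value. Put $\Lambda=\mathbb{S}^l\times\mathbb{R}^s$ and $L(x,\lambda,\mu)=f(x)+\operatorname{tr}(\lambda G(x))+\langle\mu,h(x)\rangle$. A point $x^*$ is called \emph{nondegenerate} if $$\begin{bmatrix} DG(x^*)\\ Dh(x^*)\end{bmatrix}\mathbb{R}^d+\begin{bmatrix}\operatorname{lin}T(G(x^*))\\ \{0\}\end{bmatrix}=\begin{bmatrix}\mathbb{S}^l\\ \mathbb{R}^s\end{bmatrix},$$ where $T(G(x^*))$ is the contingent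 cone at $G(x^*)$ to the cone of negative semidefinite matrices and $\operatorname{lin}$ denotes the largest linear subspace contained in a convex cone. Fix real numbers $\alpha>0$ and $\varkappa\ge 1$. Let $[\cdot]_+$ be the projection onto the cone of positive semidefinite matrices and set $$\eta(x,\lambda,\mu)=\|\nabla_x L(x,\lambda,\mu)\|^2+\operatorname{tr}(\lambda^2G(x)^2),$$ $$a(x)=\alpha-\operatorname{tr}\big([G(x)]_+^2\big)^{\varkappa},\quad b(x)=\alpha-\|h(x)\|^2,\quad p(x,\lambda)=\frac{a(x)}{1+\operatorname{tr}(\lambda^2)},\quad q(x,\mu)=\frac{b(x)}{1+\|\mu\|^2}.$$ For $c>0$ define the augmented Lagrangian by $$\mathscr{L}(x,\lambda,\mu,c)=f(x)+\frac{1}{2c\,p(x,\lambda)}\Big(\operatorname{tr}\big([cG(x)+p(x,\lambda)\lambda]_+^2\big)-p(x,\lambda)^2\operatorname{tr}(\lambda^2)\Big)+\langle\mu,h(x)\rangle+\frac{c}{2q(x,\mu)}\|h(x)\|^2+\eta(x,\lambda,\mu)$$ if $a(x)>0$ and $b(x)>0$, and $\mathscr{L}(x,\lambda,\mu,c)=+\infty$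 otherwise. The function $\mathscr{L}$ is called - \emph{globally extendedly exact} if there is $c_0>0$ such that for every $c\ge c_0$: every global minimizer $(x,\lambda,\mu)$ of $\mathscr{L}(\cdot,c)$ on $\mathbb{R}^d\times\Lambda$ satisfies $x\in\Omega^*$ and $\eta(x,\lambda,\mu)=0$; and every $(x,\lambda,\mu)\in\Omega^*\times\Lambda$ with $\eta(x,\lambda,\mu)=0$ is a global minimizer of $\mathscr{L}(\cdot,c)$ on $\mathbb{R}^d\times\Lambda$; - \emph{locally extendedly exact} at $x^*$ if for every $(\lambda^*,\mu^*)\in\Lambda$ with $\eta(x^*,\lambda^*,\mu^*)=0$ there are $c_0>0$ and a neighbourhood $U$ of $(x^*,\lambda^*,\mu^*)$ such that $\mathscr{L}(x,\lambda,\mu,c)\ge\mathscr{L}(x^*,\lambda^*,\mu^*,c)$ for all $(x,\lambda,\mu)\in U$ and all $c\ge c_0$; - \emph{non-degenerate} if there are $c_0>0$ and $R>0$ such that for every $c\ge c_0$ the function $\mathscr{L}(\cdot,c)$ has a global minimizer $(x,\lambda,\mu)$ on $\mathbb{R}^d\times\Lambda$ with $\|x\|+\|(\lambda,\mu)\|\le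 R$. **Theorem.** Suppose that every $x^*\in\Omega^*$ is nondegenerate. Then $\mathscr{L}$ is globally extendedly exact if and only if it is locally extendedly exact at every $x^*\in\Omega^*$ and at least one of the following two conditions holds: 1. $\mathscr{L}$ is non-degenerate; 2. the set $\{(x,\lambda,\mu)\in\mathbb{R}^d\times\Lambda\mid\mathscr{L}(x,\lambda,\mu,c_0)<f^*\}$ is bounded for some $c_0>0$. In particular, if the set $\Omega(\alpha,\gamma)=\{x\in\mathbb{R}^d\mid f(x)<f^*+\gamma,\ a(x)>0,\ b(x)>0\}$ is bounded for some $\gamma>0$, then $\mathscr{L}$ is globally extendedly exact if and only if it is locally extendedly exact at every $x^*\in\Omega^*$. -/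

import Mathlib

open Set Filter Topology
open scoped Matrix.Norms.Frobenius

noncomputable section

/-! ### Extended exactness of separating functions

The problem is posed on the whole space `X`, `Sol` is the set of its globally optimal solutions,
`Λ` is the space of parameters, `F x ν c` is a separating function with penalty parameter `c > 0`,
and `η` selects the parameters that correspond to a globally optimal solution. -/

namespace Separating

variable {X Λ : Type*} [NormedAddCommGroup X] [NormedAddCommGroup Λ]

/-- `ξ = (x, ν)` is a point of global minimum of `F(·, ·, c)` on `X × Λ`. -/
def IsGlobalMinimizer (F : X → Λ → ℝ → EReal) (c : ℝ) (ξ : X × Λ) : Prop :=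
  ∀ ζ : X × Λ, F ξ.1 ξ.2 c ≤ F ζ.1 ζ.2 c

/-- Global extended exactness with respect to `η`. -/
def GloballyExtendedlyExact (Sol : Set X) (F : X → Λ → ℝ → EReal) (η : X → Λ → ℝ) : Prop :=
  ∃ c₀ : ℝ, 0 < c₀ ∧ ∀ c : ℝ, c₀ ≤ c →
    (∀ (x : X) (ν : Λ), IsGlobalMinimizer F c (x, ν) → η x ν = 0 ∧ x ∈ Sol) ∧
    (∀ x ∈ Sol, ∀ ν : Λ, η x ν = 0 → IsGlobalMinimizer F c (x, ν))

/-- Local extended exactness at the point `x` with respect to `η`. -/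
def LocallyExtendedlyExactAt (F : X → Λ → ℝ → EReal) (η : X → Λ → ℝ) (x : X) : Prop :=
  ∀ ν : Λ, η x ν = 0 →
    ∃ c₀ : ℝ, 0 < c₀ ∧ ∃ U ∈ 𝓝 (x, ν), ∀ ζ ∈ U, ∀ c : ℝ, c₀ ≤ c → F x ν c ≤ F ζ.1 ζ.2 c

/-- Non-degeneracy: for all large `c` there is a global minimizer in a fixed ball. -/
def NonDegenerate (F : X → Λ → ℝ → EReal) : Prop :=
  ∃ c₀ : ℝ, 0 < c₀ ∧ ∃ R : ℝ, 0 < R ∧ ∀ c : ℝ, c₀ ≤ c →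
    ∃ (x : X) (ν : Λ), IsGlobalMinimizer F c (x, ν) ∧ ‖x‖ + ‖ν‖ ≤ R

end Separating

/-! ### Symmetric matrices -/

/-- The subspace of real symmetric `l × l` matrices. -/
def symSubmodule (l : ℕ) : Submodule ℝ (Matrix (Fin l) (Fin l) ℝ) where
  carrier := {A | A.IsSymm}
  add_mem' hA hB := hA.add hB
  zero_mem' := Matrix.isSymm_zero
  smul_mem' c _ hA := hA.smul c

/-- The space of real symmetric `l × l` matrices, with the Frobenius norm. -/
abbrev SymMat (l : ℕ) : Type := symSubmodule l

/-- The trace inner product `tr (A B)` of symmetric matrices; `trInner A A` is `tr (A ^ 2)`. -/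
def trInner {l : ℕ} (A B : SymMat l) : ℝ :=
  Matrix.trace ((A : Matrix (Fin l) (Fin l) ℝ) * (B : Matrix (Fin l) (Fin l) ℝ))

/-- The cone of positive semidefinite matrices. -/
def psdCone (l : ℕ) : Set (SymMat l) := {A | (A : Matrix (Fin l) (Fin l) ℝ).PosSemidef}

/-- The cone of negative semidefinite matrices. -/
def nsdCone (l : ℕ) : Set (SymMat l) := {A | -A ∈ psdCone l}

theorem isClosed_psdCone (l : ℕ) : IsClosed (psdCone l) := by
  have h : psdCone l = ⋂ x : Fin l → ℝ,
      {A : SymMat l | 0 ≤ star x ⬝ᵥ ((A : Matrix (Fin l) (Fin l) ℝ).mulVec x)} := by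
    ext A
    have hA : (A : Matrix (Fin l) (Fin l) ℝ).IsHermitian := by
      rw [Matrix.IsHermitian, Matrix.conjTranspose_eq_transpose_of_trivial]
      exact A.2
    simp only [psdCone, mem_ofPred_eq, mem_iInter]
    rw [Matrix.posSemidef_iff_dotProduct_mulVec]
    exact and_iff_right hA
  rw [h]
  refine isClosed_iInter fun x => isClosed_le continuous_const ?_
  fun_prop

/-- Existence of a Frobenius-nearest positive semidefinite matrix. -/
theorem exists_psd_nearest {l : ℕ} (A : SymMat l) :
    ∃ Z ∈ psdCone l, ∀ W ∈ psdCone l, ‖A - Z‖ ≤ ‖A - W‖ := by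
  have hne : (psdCone l).Nonempty := ⟨0, by simpa [psdCone] using Matrix.PosSemidef.zero⟩
  obtain ⟨Z, hZ, hd⟩ := (isClosed_psdCone l).exists_infDist_eq_dist hne A
  refine ⟨Z, hZ, fun W hW => ?_⟩
  rw [← dist_eq_norm, ← dist_eq_norm, ← hd]
  exact Metric.infDist_le_dist_of_mem hW

/-- `[A]₊`: the projection of `A` onto the cone of positive semidefinite matrices, i.e. the
nearest positive semidefinite matrix in the Frobenius norm (unique, as the cone is convex). -/
def psdProj {l : ℕ} (A : SymMat l) : SymMat l := (exists_psd_nearest A).choose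

theorem psdProj_mem {l : ℕ} (A : SymMat l) : psdProj A ∈ psdCone l :=
  (exists_psd_nearest A).choose_spec.1

theorem psdProj_nearest {l : ℕ} (A : SymMat l) :
    ∀ W ∈ psdCone l, ‖A - psdProj A‖ ≤ ‖A - W‖ :=
  (exists_psd_nearest A).choose_spec.2

/-- The lineality subspace of a convex cone `C`: the largest linear subspace contained in `C`. -/
def lineality {E : Type*} [AddCommGroup E] [Module ℝ E] (C : Set E) : Submodule ℝ E :=
  sSup {S : Submodule ℝ E | (S : Set E) ⊆ C}

/-- For a cone `C` closed under addition, `lineality C` is indeed the greatest subspace in `C`. -/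
theorem lineality_isGreatest {E : Type*} [AddCommGroup E] [Module ℝ E] (C : Set E)
    (h0 : (0 : E) ∈ C) (hadd : ∀ x ∈ C, ∀ y ∈ C, x + y ∈ C) :
    IsGreatest {S : Submodule ℝ E | (S : Set E) ⊆ C} (lineality C) := by
  refine ⟨fun v hv => ?_, fun S hS => le_sSup hS⟩
  have hv' : v ∈ ⨆ S : {S : Submodule ℝ E | (S : Set E) ⊆ C}, (S : Submodule ℝ E) := by
    rw [← sSup_eq_iSup']
    exact hv
  exact Submodule.iSup_induction _ (motive := fun v => v ∈ C) hv' (fun S x hx => S.2 hx) h0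
    (fun x y hx hy => hadd x hx y hy)

/-! ### Nonlinear semidefinite programs and the augmented Lagrangian -/

/-- The data of the problem: minimize `f x` subject to `G x ⪯ 0`, `h x = 0`, over `ℝᵈ`. -/
structure SDProgram (d l s : ℕ) where
  f : EuclideanSpace ℝ (Fin d) → ℝ
  G : EuclideanSpace ℝ (Fin d) → SymMat l
  h : EuclideanSpace ℝ (Fin d) → EuclideanSpace ℝ (Fin s)

/-- The parameter space `Λ = 𝕊ˡ × ℝˢ` of the multipliers `ν = (lam, μ)`. -/
abbrev Multiplier (l s : ℕ) : Type := SymMat l × EuclideanSpace ℝ (Fin s)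

namespace SDProgram

variable {d l s : ℕ} (P : SDProgram d l s)

/-- The feasible set. -/
def feasible : Set (EuclideanSpace ℝ (Fin d)) := {x | P.G x ∈ nsdCone l ∧ P.h x = 0}

/-- The set of globally optimal solutions. -/
def globalSol : Set (EuclideanSpace ℝ (Fin d)) :=
  {x | x ∈ P.feasible ∧ ∀ y ∈ P.feasible, P.f x ≤ P.f y}

/-- The (standard) Lagrangian. -/
def lagrangian (x : EuclideanSpace ℝ (Fin d)) (ν : Multiplier l s) : ℝ :=
  P.f x + trInner ν.1 (P.G x) + inner ℝ ν.2 (P.h x)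

/-- `η(x, lam, μ) = ‖∇ₓ L(x, lam, μ)‖² + tr(lam² G(x)²)`. -/
def eta (x : EuclideanSpace ℝ (Fin d)) (ν : Multiplier l s) : ℝ :=
  ‖gradient (fun y => P.lagrangian y ν) x‖ ^ 2 +
    Matrix.trace ((ν.1 : Matrix (Fin l) (Fin l) ℝ) ^ 2 *
      (P.G x : Matrix (Fin l) (Fin l) ℝ) ^ 2)

/-- Constraint nondegeneracy at `x`: the range of `(DG(x), Dh(x))` and
`lin T(G(x)) × {0}` together span `𝕊ˡ × ℝˢ`, where `T(G(x))` is the contingent cone to the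
negative semidefinite cone at `G(x)`. -/
def NondegenerateAt (x : EuclideanSpace ℝ (Fin d)) : Prop :=
  LinearMap.range ((fderiv ℝ P.G x).prod (fderiv ℝ P.h x)).toLinearMap ⊔
    (lineality (posTangentConeAt (nsdCone l) (P.G x))).prod ⊥ = ⊤

/-- `a(x) = α - tr([G(x)]₊²) ^ ϰ`. -/
def aFun (α κ : ℝ) (x : EuclideanSpace ℝ (Fin d)) : ℝ :=
  α - trInner (psdProj (P.G x)) (psdProj (P.G x)) ^ κ

/-- `b(x) = α - ‖h(x)‖²`. -/
def bFun (α : ℝ) (x : EuclideanSpace ℝ (Fin d)) : ℝ := α - ‖P.h x‖ ^ 2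

/-- `p(x, lam) = a(x) / (1 + tr(lam²))`. -/
def pFun (α κ : ℝ) (x : EuclideanSpace ℝ (Fin d)) (lam : SymMat l) : ℝ :=
  P.aFun α κ x / (1 + trInner lam lam)

/-- `q(x, μ) = b(x) / (1 + ‖μ‖²)`. -/
def qFun (α : ℝ) (x : EuclideanSpace ℝ (Fin d)) (μ : EuclideanSpace ℝ (Fin s)) : ℝ :=
  P.bFun α x / (1 + ‖μ‖ ^ 2)

/-- The finite part of the augmented Lagrangian, used where `a(x) > 0` and `b(x) > 0`. -/
def augLagFinite (α κ : ℝ) (x : EuclideanSpace ℝ (Fin d)) (ν : Multiplier l s) (c : ℝ) : ℝ :=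
  P.f x
    + 1 / (2 * c * P.pFun α κ x ν.1) *
      (trInner (psdProj (c • P.G x + P.pFun α κ x ν.1 • ν.1))
          (psdProj (c • P.G x + P.pFun α κ x ν.1 • ν.1))
        - P.pFun α κ x ν.1 ^ 2 * trInner ν.1 ν.1)
    + inner ℝ ν.2 (P.h x) + c / (2 * P.qFun α x ν.2) * ‖P.h x‖ ^ 2 + P.eta x ν

open scoped Classical in
/-- The augmented Lagrangian, equal to `+∞` unless `a(x) > 0` and `b(x) > 0`. -/
def augLag (α κ : ℝ) (x : EuclideanSpace ℝ (Fin d)) (ν : Multiplier l s) (c : ℝ) : EReal :=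
  if 0 < P.aFun α κ x ∧ 0 < P.bFun α x then ((P.augLagFinite α κ x ν c : ℝ) : EReal) else ⊤

/-- `Ω(α, γ) = {x | f(x) < f* + γ, a(x) > 0, b(x) > 0}`, where `fstar` stands for `f*`. -/
def omegaSet (α κ fstar γ : ℝ) : Set (EuclideanSpace ℝ (Fin d)) :=
  {x | P.f x < fstar + γ ∧ 0 < P.aFun α κ x ∧ 0 < P.bFun α x}

end SDProgram

end

noncomputable section

/-! ### The trace inner product -/

/-! Global exactness amounts to the inequality `f* ≤ augLag` everywhere for a single penalty
parameter (`globallyExtendedlyExact_iff`). Indeed, an optimal nondegenerate point has a positive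
semidefinite KKT multiplier (`exists_psd_multiplier`), and this is the only zero of `η` there, so
`augLag` equals `f*` at all such pairs for every `c > 0`. Moreover, the projection term is the
minimum of `⟨lam, Y⟩ + c/(2p) ‖Y‖²` over `Y` with `G x - Y ⪯ 0`. Hence `augLag` is monotone in `c`,
and where it is finite it can stay constant only if `Y = 0` and `h x = 0`, that is, at feasible `x`.

The passage from local to global rests on `augLagFinite_lower_bound`: since `p ‖lam‖²` and `q ‖μ‖²`
are at most `α`, completing squares bounds `augLag` below by `f + c/(4α) · violation - 2α/c + η`,
where multipliers enter only through `η`. If `augLag < f*` at points with bounded `x` and `c → ∞`,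
the violation tends to zero, the limit of a subsequence is optimal, and `η` stays bounded.
Nondegeneracy then bounds the multipliers, and `η` vanishes in the limit, which contradicts local
exactness there (`exists_penalty_of_locallyExact`). Each of the two conditions, or boundedness of
`Ω(α, γ)`, reduces the inequality to `x` in a fixed ball. -/

theorem trInner_eq_sum {l : ℕ} (A B : SymMat l) :
    trInner A B = ∑ i, ∑ j, (A : Matrix (Fin l) (Fin l) ℝ) i j *
      (B : Matrix (Fin l) (Fin l) ℝ) i j := by
  have hB : ∀ i j, (B : Matrix (Fin l) (Fin l) ℝ) i j = (B : Matrix (Fin l) (Fin l) ℝ) j i :=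
    fun i j => (Matrix.IsSymm.apply B.2 i j).symm
  simp only [trInner, Matrix.trace, Matrix.diag, Matrix.mul_apply]
  exact Finset.sum_congr rfl fun i _ => Finset.sum_congr rfl fun j _ => by rw [hB j i]

theorem frobenius_norm_sq {m n : ℕ} (A : Matrix (Fin m) (Fin n) ℝ) :
    ‖A‖ ^ 2 = Matrix.trace (A.transpose * A) := by
  rw [Matrix.frobenius_norm_def, ← Real.sqrt_eq_rpow, Real.sq_sqrt (by positivity)]
  simp only [Matrix.trace, Matrix.diag, Matrix.mul_apply, Matrix.transpose_apply]
  rw [Finset.sum_comm]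
  exact Finset.sum_congr rfl fun i _ => Finset.sum_congr rfl fun j _ => by
    rw [Real.rpow_two, Real.norm_eq_abs, sq_abs, sq]

/-- The trace inner product, compatible with the Frobenius norm. -/
abbrev symMatInnerProductSpace (l : ℕ) : InnerProductSpace ℝ (SymMat l) where
  inner A B := trInner A B
  norm_sq_eq_re_inner A := by
    have h : ‖A‖ ^ 2 = ‖(A : Matrix (Fin l) (Fin l) ℝ)‖ ^ 2 := rfl
    rw [h, frobenius_norm_sq, show (A : Matrix (Fin l) (Fin l) ℝ).transpose = A from A.2]
    rfl
  conj_inner_symm A B := by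
    simp only [conj_trivial, trInner_eq_sum]
    simp only [mul_comm]
  add_left A B C := by
    simp [trInner, add_mul, Matrix.trace_add]
  smul_left A B r := by
    simp [trInner, Matrix.trace_smul]

attribute [local instance] symMatInnerProductSpace

theorem inner_eq_trInner {l : ℕ} (A B : SymMat l) : inner ℝ A B = trInner A B := rfl

theorem trInner_self {l : ℕ} (A : SymMat l) : trInner A A = ‖A‖ ^ 2 :=
  real_inner_self_eq_norm_sq A

/-! ### The cones of semidefinite matrices -/

theorem posSemidef_eq_transpose_mul_self {l : ℕ} {A : Matrix (Fin l) (Fin l) ℝ}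
    (hA : A.PosSemidef) : ∃ C : Matrix (Fin l) (Fin l) ℝ, A = C.transpose * C := by
  classical
  open scoped MatrixOrder in
  obtain ⟨C, hC⟩ := CStarAlgebra.nonneg_iff_eq_star_mul_self.mp hA.nonneg
  exact ⟨C, by simpa [Matrix.star_eq_conjTranspose,
    Matrix.conjTranspose_eq_transpose_of_trivial] using hC⟩

/-- Cyclicity of the trace. Both the sign of the pairing on the cone and complementarity (zero
pairing forces zero product) are read off from this square. -/
theorem trInner_transpose_mul_self {l : ℕ} {A B : SymMat l} {C D : Matrix (Fin l) (Fin l) ℝ}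
    (hC : (A : Matrix (Fin l) (Fin l) ℝ) = C.transpose * C)
    (hD : (B : Matrix (Fin l) (Fin l) ℝ) = D.transpose * D) :
    trInner A B = ‖D * C.transpose‖ ^ 2 := by
  rw [frobenius_norm_sq, trInner, hC, hD, Matrix.trace_mul_comm]
  simp only [Matrix.transpose_mul, Matrix.transpose_transpose, Matrix.mul_assoc]
  rw [Matrix.trace_mul_comm C]
  simp only [Matrix.mul_assoc]

theorem trInner_nonneg_of_psd {l : ℕ} {A B : SymMat l} (hA : A ∈ psdCone l)
    (hB : B ∈ psdCone l) : 0 ≤ trInner A B := by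
  obtain ⟨C, hC⟩ := posSemidef_eq_transpose_mul_self hA
  obtain ⟨D, hD⟩ := posSemidef_eq_transpose_mul_self hB
  rw [trInner_transpose_mul_self hC hD]
  positivity

theorem mul_eq_zero_of_trInner_eq_zero {l : ℕ} {A B : SymMat l} (hA : A ∈ psdCone l)
    (hB : B ∈ psdCone l) (h0 : trInner A B = 0) :
    (A : Matrix (Fin l) (Fin l) ℝ) * (B : Matrix (Fin l) (Fin l) ℝ) = 0 := by
  obtain ⟨C, hC⟩ := posSemidef_eq_transpose_mul_self hA
  obtain ⟨D, hD⟩ := posSemidef_eq_transpose_mul_self hB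
  rw [trInner_transpose_mul_self hC hD] at h0
  have h1 : D * C.transpose = 0 := norm_eq_zero.mp ((pow_eq_zero_iff two_ne_zero).mp h0)
  have h2 : C * D.transpose = 0 := by
    have := congrArg Matrix.transpose h1
    simpa using this
  rw [hC, hD, Matrix.mul_assoc, ← Matrix.mul_assoc C, h2]
  simp

theorem zero_mem_psdCone (l : ℕ) : (0 : SymMat l) ∈ psdCone l := by
  simpa [psdCone] using Matrix.PosSemidef.zero

theorem add_mem_psdCone {l : ℕ} {A B : SymMat l} (hA : A ∈ psdCone l) (hB : B ∈ psdCone l) :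
    A + B ∈ psdCone l :=
  Matrix.PosSemidef.add hA hB

theorem smul_mem_psdCone {l : ℕ} {A : SymMat l} (hA : A ∈ psdCone l) {t : ℝ} (ht : 0 ≤ t) :
    t • A ∈ psdCone l :=
  Matrix.PosSemidef.smul hA ht

theorem convex_psdCone (l : ℕ) : Convex ℝ (psdCone l) := fun _ hA _ hB _ _ ha hb _ =>
  add_mem_psdCone (smul_mem_psdCone hA ha) (smul_mem_psdCone hB hb)

/-- Testing against rank-one matrices `x xᵀ` recovers the quadratic form of `A`; this is the harder
half of self-duality of the cone. -/
theorem mem_psdCone_of_trInner_nonneg {l : ℕ} {A : SymMat l}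
    (h : ∀ W ∈ psdCone l, 0 ≤ trInner A W) : A ∈ psdCone l := by
  have hA : (A : Matrix (Fin l) (Fin l) ℝ).IsHermitian := by
    rw [Matrix.IsHermitian, Matrix.conjTranspose_eq_transpose_of_trivial]
    exact A.2
  refine Matrix.PosSemidef.of_dotProduct_mulVec_nonneg hA fun x => ?_
  have hW := Matrix.posSemidef_vecMulVec_self_star x
  have hs : (Matrix.vecMulVec x (star x)).IsSymm := by
    have := hW.isHermitian
    rwa [Matrix.IsHermitian, Matrix.conjTranspose_eq_transpose_of_trivial] at this
  have h1 := h ⟨Matrix.vecMulVec x (star x), hs⟩ hW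
  have h2 : trInner A ⟨Matrix.vecMulVec x (star x), hs⟩ =
      star x ⬝ᵥ ((A : Matrix (Fin l) (Fin l) ℝ).mulVec x) := by
    simp only [trInner, Matrix.mul_vecMulVec, Matrix.trace_vecMulVec]
    rw [dotProduct_comm]
  rwa [h2] at h1

/-! ### The projection onto the cone of positive semidefinite matrices -/

theorem inner_sub_psdProj_le {l : ℕ} (A W : SymMat l) (hW : W ∈ psdCone l) :
    inner ℝ (A - psdProj A) (W - psdProj A) ≤ 0 := by
  have hne : Nonempty (psdCone l) := ⟨⟨psdProj A, psdProj_mem A⟩⟩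
  refine (norm_eq_iInf_iff_real_inner_le_zero (convex_psdCone l) (psdProj_mem A)).mp ?_ W hW
  refine le_antisymm (le_ciInf fun w => psdProj_nearest A w w.2) ?_
  exact ciInf_le (f := fun w : psdCone l => ‖A - w‖) ⟨0, by rintro _ ⟨w, rfl⟩; positivity⟩
    ⟨psdProj A, psdProj_mem A⟩

theorem inner_sub_psdProj_self {l : ℕ} (A : SymMat l) :
    inner ℝ (psdProj A - A) (psdProj A) = 0 := by
  -- Testing with `0` and with twice the projection, both in the cone, gives the two opposite
  -- inequalities.
  have h0 := inner_sub_psdProj_le A 0 (zero_mem_psdCone l)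
  have h2 := inner_sub_psdProj_le A ((2 : ℝ) • psdProj A)
    (smul_mem_psdCone (psdProj_mem A) (by norm_num))
  rw [two_smul, add_sub_cancel_right] at h2
  rw [zero_sub, inner_neg_right] at h0
  rw [← neg_sub A, inner_neg_left]
  linarith

theorem psdProj_sub_self_mem {l : ℕ} (A : SymMat l) : psdProj A - A ∈ psdCone l := by
  refine mem_psdCone_of_trInner_nonneg fun W hW => ?_
  have h := inner_sub_psdProj_le A W hW
  have h0 := inner_sub_psdProj_self A
  rw [← inner_eq_trInner]
  rw [inner_sub_right] at h
  rw [← neg_sub A, inner_neg_left] at h0 ⊢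
  linarith

/-- The negative semidefinite part of `A`. -/
theorem sub_psdProj_mem_nsdCone {l : ℕ} (A : SymMat l) : A - psdProj A ∈ nsdCone l := by
  rw [nsdCone, mem_ofPred_eq, neg_sub]
  exact psdProj_sub_self_mem A

/-- `‖[A]₊‖` is the distance from `A` to the cone of negative semidefinite matrices. -/
theorem norm_psdProj_le {l : ℕ} (A W : SymMat l) (hW : W ∈ nsdCone l) :
    ‖psdProj A‖ ≤ ‖A - W‖ := by
  have h1 := trInner_nonneg_of_psd (psdProj_mem A) hW
  have h2 := inner_sub_psdProj_self A
  rw [← inner_eq_trInner, inner_neg_right] at h1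
  rw [inner_sub_left, real_inner_self_eq_norm_sq] at h2
  have h3 : ‖psdProj A‖ ^ 2 ≤ inner ℝ (psdProj A) (A - W) := by
    rw [inner_sub_right, real_inner_comm]
    linarith
  have h4 := h3.trans (real_inner_le_norm _ _)
  rw [sq] at h4
  by_contra hlt
  push Not at hlt
  nlinarith [norm_nonneg (A - W), norm_nonneg (psdProj A)]

theorem psdProj_eq_zero {l : ℕ} {A : SymMat l} (hA : A ∈ nsdCone l) : psdProj A = 0 := by
  have := norm_psdProj_le A A hA
  rw [sub_self, norm_zero] at this
  exact norm_le_zero_iff.mp this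

theorem psdProj_mul_sub {l : ℕ} (A : SymMat l) :
    (psdProj A : Matrix (Fin l) (Fin l) ℝ) * (psdProj A - A : SymMat l) = 0 := by
  refine mul_eq_zero_of_trInner_eq_zero (psdProj_mem A) (psdProj_sub_self_mem A) ?_
  rw [← inner_eq_trInner, real_inner_comm]
  exact inner_sub_psdProj_self A

theorem psdProj_mul_self {l : ℕ} (A : SymMat l) :
    (psdProj A : Matrix (Fin l) (Fin l) ℝ) * (A : Matrix (Fin l) (Fin l) ℝ) =
      (psdProj A : Matrix (Fin l) (Fin l) ℝ) * (psdProj A : Matrix (Fin l) (Fin l) ℝ) := by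
  have h := psdProj_mul_sub A
  rw [Submodule.coe_sub, mul_sub, sub_eq_zero] at h
  exact h.symm

theorem norm_psdProj_eq_infDist {l : ℕ} (A : SymMat l) :
    ‖psdProj A‖ = Metric.infDist A (nsdCone l) := by
  refine le_antisymm ((Metric.le_infDist ⟨_, sub_psdProj_mem_nsdCone A⟩).mpr fun W hW => ?_) ?_
  · rw [dist_eq_norm]
    exact norm_psdProj_le A W hW
  · refine (Metric.infDist_le_dist_of_mem (sub_psdProj_mem_nsdCone A)).trans ?_
    rw [dist_eq_norm, sub_sub_cancel]

theorem continuous_norm_psdProj (l : ℕ) : Continuous fun A : SymMat l => ‖psdProj A‖ := by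
  simp only [norm_psdProj_eq_infDist]
  exact Metric.continuous_infDist_pt _

theorem mem_nsdCone_of_norm_psdProj_eq_zero {l : ℕ} {A : SymMat l} (h : ‖psdProj A‖ = 0) :
    A ∈ nsdCone l := by
  have := sub_psdProj_mem_nsdCone A
  rwa [norm_eq_zero.mp h, sub_zero] at this

/-- A matrix annihilated by `G` is orthogonal to every subspace of the contingent cone at `G`. -/
theorem inner_eq_zero_of_mem_lineality {l : ℕ} {G lam : SymMat l}
    (h : (lam : Matrix (Fin l) (Fin l) ℝ) * (G : Matrix (Fin l) (Fin l) ℝ) = 0)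
    {v : SymMat l} (hv : v ∈ lineality (posTangentConeAt (nsdCone l) G)) :
    inner ℝ lam v = 0 := by
  -- the claim for semidefinite matrices, by Fermat's rule for `W ↦ tr (Q W)` on the cone
  have key : ∀ Q ∈ psdCone l, (Q : Matrix (Fin l) (Fin l) ℝ) * (G : Matrix (Fin l) (Fin l) ℝ) = 0 →
      ∀ w, w ∈ posTangentConeAt (nsdCone l) G → -w ∈ posTangentConeAt (nsdCone l) G →
      inner ℝ Q w = 0 := by
    intro Q hQ hQG w hw hw'
    have hmax : IsMaxOn (fun W => innerSL ℝ Q W) (nsdCone l) G := by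
      intro W hW
      have h0 : inner ℝ Q G = 0 := by rw [inner_eq_trInner, trInner, hQG, Matrix.trace_zero]
      have h1 := trInner_nonneg_of_psd hQ hW
      rw [← inner_eq_trInner, inner_neg_right] at h1
      simp only [mem_ofPred_eq, innerSL_apply_apply, h0]
      linarith
    have := hmax.localize.hasFDerivWithinAt_eq_zero
      (innerSL ℝ Q).hasFDerivAt.hasFDerivWithinAt hw hw'
    simpa using this
  -- `lam = Q - (Q - lam)` is a difference of positive semidefinite matrices; both are shown to
  -- annihilate `G`, so `key` applies to each.
  set Q := psdProj lam with hQdef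
  have hGlam : (G : Matrix (Fin l) (Fin l) ℝ) * (lam : Matrix (Fin l) (Fin l) ℝ) = 0 := by
    have := congrArg Matrix.transpose h
    rwa [Matrix.transpose_mul, show (G : Matrix (Fin l) (Fin l) ℝ).transpose = G from G.2,
      show (lam : Matrix (Fin l) (Fin l) ℝ).transpose = lam from lam.2,
      Matrix.transpose_zero] at this
  have hlamQ : (lam : Matrix (Fin l) (Fin l) ℝ) * (Q : Matrix (Fin l) (Fin l) ℝ) =
      (Q : Matrix (Fin l) (Fin l) ℝ) * (Q : Matrix (Fin l) (Fin l) ℝ) := by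
    have := congrArg Matrix.transpose (psdProj_mul_self lam)
    rwa [Matrix.transpose_mul, Matrix.transpose_mul,
      show (lam : Matrix (Fin l) (Fin l) ℝ).transpose = lam from lam.2,
      show (psdProj lam : Matrix (Fin l) (Fin l) ℝ).transpose = psdProj lam
        from (psdProj lam).2] at this
  have hQG : (Q : Matrix (Fin l) (Fin l) ℝ) * (G : Matrix (Fin l) (Fin l) ℝ) = 0 := by
    -- `‖Q G‖² = tr(G Q Q G) = tr(G lam Q G)`, and `G lam = 0`.
    have hsq : ‖(Q : Matrix (Fin l) (Fin l) ℝ) * (G : Matrix (Fin l) (Fin l) ℝ)‖ ^ 2 = 0 := by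
      rw [frobenius_norm_sq, Matrix.transpose_mul,
        show (G : Matrix (Fin l) (Fin l) ℝ).transpose = G from G.2,
        show (Q : Matrix (Fin l) (Fin l) ℝ).transpose = Q from Q.2, Matrix.mul_assoc,
        ← Matrix.mul_assoc (Q : Matrix (Fin l) (Fin l) ℝ), ← hlamQ, Matrix.mul_assoc,
        ← Matrix.mul_assoc (G : Matrix (Fin l) (Fin l) ℝ), hGlam, Matrix.zero_mul,
        Matrix.trace_zero]
    exact norm_eq_zero.mp (pow_eq_zero_iff two_ne_zero |>.mp hsq)
  suffices hle : lineality (posTangentConeAt (nsdCone l) G) ≤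
      LinearMap.ker (innerSL ℝ lam).toLinearMap by
    simpa using hle hv
  refine sSup_le fun S hS w hw => ?_
  have h1 := key Q (psdProj_mem lam) hQG w (hS hw) (hS (S.neg_mem hw))
  have h2 := key (Q - lam) (psdProj_sub_self_mem lam)
    (by rw [Submodule.coe_sub, sub_mul, hQG, h, sub_zero]) w (hS hw) (hS (S.neg_mem hw))
  rw [inner_sub_left, h1] at h2
  simpa using h2

namespace SDProgram

variable {d l s : ℕ} (P : SDProgram d l s)

/-! ### The derivative of the Lagrangian and the function `η` -/

/-- The functional `DG(x)* lam + Dh(x)* μ`. -/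
def multDeriv (x : EuclideanSpace ℝ (Fin d)) (ν : Multiplier l s) :
    EuclideanSpace ℝ (Fin d) →L[ℝ] ℝ :=
  (innerSL ℝ ν.1).comp (fderiv ℝ P.G x) + (innerSL ℝ ν.2).comp (fderiv ℝ P.h x)

theorem multDeriv_apply (x v : EuclideanSpace ℝ (Fin d)) (ν : Multiplier l s) :
    P.multDeriv x ν v = inner ℝ ν.1 (fderiv ℝ P.G x v) + inner ℝ ν.2 (fderiv ℝ P.h x v) := rfl

theorem multDeriv_sub (x : EuclideanSpace ℝ (Fin d)) (ν ν' : Multiplier l s) :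
    P.multDeriv x (ν - ν') = P.multDeriv x ν - P.multDeriv x ν' := by
  ext v
  simp only [multDeriv_apply, sub_apply, Prod.fst_sub, Prod.snd_sub,
    inner_sub_left]
  ring

theorem multDeriv_smul (x : EuclideanSpace ℝ (Fin d)) (t : ℝ) (ν : Multiplier l s) :
    P.multDeriv x (t • ν) = t • P.multDeriv x ν := by
  ext v
  have h1 := real_inner_smul_left ν.1 (fderiv ℝ P.G x v) t
  have h2 := real_inner_smul_left ν.2 (fderiv ℝ P.h x v) t
  simp only [multDeriv_apply, smul_apply, smul_eq_mul, mul_add, ← h1, ← h2]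
  rfl

variable {P}

theorem hasFDerivAt_lagrangian (hf : ContDiff ℝ 1 P.f) (hG : ContDiff ℝ 1 P.G)
    (hh : ContDiff ℝ 1 P.h) (x : EuclideanSpace ℝ (Fin d)) (ν : Multiplier l s) :
    HasFDerivAt (fun y => P.lagrangian y ν) (fderiv ℝ P.f x + P.multDeriv x ν) x := by
  have h1 := (hf.differentiable one_ne_zero x).hasFDerivAt
  have h2 := (innerSL ℝ ν.1).hasFDerivAt.comp x (hG.differentiable one_ne_zero x).hasFDerivAt
  have h3 := (innerSL ℝ ν.2).hasFDerivAt.comp x (hh.differentiable one_ne_zero x).hasFDerivAt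
  rw [multDeriv, ← add_assoc]
  exact (h1.add h2).add h3

/-- By cyclicity of the trace `η` is a sum of squares, whose zeros are the stationary, complementary
pairs; no sign of `lam` is encoded. -/
theorem eta_eq (hf : ContDiff ℝ 1 P.f) (hG : ContDiff ℝ 1 P.G)
    (hh : ContDiff ℝ 1 P.h) (x : EuclideanSpace ℝ (Fin d)) (ν : Multiplier l s) :
    P.eta x ν = ‖fderiv ℝ P.f x + P.multDeriv x ν‖ ^ 2 +
      ‖(ν.1 : Matrix (Fin l) (Fin l) ℝ) * (P.G x : Matrix (Fin l) (Fin l) ℝ)‖ ^ 2 := by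
  have h1 : ‖gradient (fun y => P.lagrangian y ν) x‖ = ‖fderiv ℝ P.f x + P.multDeriv x ν‖ := by
    rw [gradient, LinearIsometryEquiv.norm_map, (hasFDerivAt_lagrangian hf hG hh x ν).fderiv]
  rw [eta, h1, frobenius_norm_sq, Matrix.transpose_mul,
    show (P.G x : Matrix (Fin l) (Fin l) ℝ).transpose = P.G x from (P.G x).2,
    show (ν.1 : Matrix (Fin l) (Fin l) ℝ).transpose = ν.1 from ν.1.2, sq
    (ν.1 : Matrix (Fin l) (Fin l) ℝ), sq (P.G x : Matrix (Fin l) (Fin l) ℝ),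
    Matrix.mul_assoc (P.G x : Matrix (Fin l) (Fin l) ℝ),
    Matrix.trace_mul_comm (P.G x : Matrix (Fin l) (Fin l) ℝ)]
  simp only [Matrix.mul_assoc]

theorem eta_nonneg (hf : ContDiff ℝ 1 P.f) (hG : ContDiff ℝ 1 P.G)
    (hh : ContDiff ℝ 1 P.h) (x : EuclideanSpace ℝ (Fin d)) (ν : Multiplier l s) :
    0 ≤ P.eta x ν := by
  rw [eta_eq hf hG hh]
  positivity

theorem continuous_multDeriv (hG : ContDiff ℝ 1 P.G) (hh : ContDiff ℝ 1 P.h) :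
    Continuous fun z : EuclideanSpace ℝ (Fin d) × Multiplier l s => P.multDeriv z.1 z.2 := by
  have h2 := hG.continuous_fderiv one_ne_zero
  have h3 := hh.continuous_fderiv one_ne_zero
  have h4 : Continuous fun z : EuclideanSpace ℝ (Fin d) × Multiplier l s =>
      innerSL ℝ z.2.1 := (innerSL ℝ).continuous.comp (by fun_prop)
  have h5 : Continuous fun z : EuclideanSpace ℝ (Fin d) × Multiplier l s =>
      innerSL ℝ z.2.2 := (innerSL ℝ).continuous.comp (by fun_prop)
  exact (h4.clm_comp (h2.comp continuous_fst)).add (h5.clm_comp (h3.comp continuous_fst))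

theorem continuous_mul_G (hG : ContDiff ℝ 1 P.G) :
    Continuous fun z : EuclideanSpace ℝ (Fin d) × Multiplier l s =>
      (z.2.1 : Matrix (Fin l) (Fin l) ℝ) * (P.G z.1 : Matrix (Fin l) (Fin l) ℝ) := by
  have h1 := hG.continuous
  fun_prop

theorem continuous_eta (hf : ContDiff ℝ 1 P.f) (hG : ContDiff ℝ 1 P.G)
    (hh : ContDiff ℝ 1 P.h) :
    Continuous fun z : EuclideanSpace ℝ (Fin d) × Multiplier l s => P.eta z.1 z.2 := by
  simp only [eta_eq hf hG hh]
  have h1 := (hf.continuous_fderiv one_ne_zero).comp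
    (continuous_fst (X := EuclideanSpace ℝ (Fin d)) (Y := Multiplier l s))
  exact ((h1.add (continuous_multDeriv hG hh)).norm.pow 2).add ((continuous_mul_G hG).norm.pow 2)

/-! ### Consequences of nondegeneracy -/

/-- Such a `ν` is orthogonal to both summands in the nondegeneracy condition, by `h1` and by
`inner_eq_zero_of_mem_lineality`, hence to the whole space. -/
theorem NondegenerateAt.eq_zero {x : EuclideanSpace ℝ (Fin d)} (hx : P.NondegenerateAt x)
    {ν : Multiplier l s} (h1 : P.multDeriv x ν = 0)
    (h2 : (ν.1 : Matrix (Fin l) (Fin l) ℝ) * (P.G x : Matrix (Fin l) (Fin l) ℝ) = 0) :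
    ν = 0 := by
  have hle : LinearMap.range ((fderiv ℝ P.G x).prod (fderiv ℝ P.h x)).toLinearMap ⊔
      (lineality (posTangentConeAt (nsdCone l) (P.G x))).prod ⊥ ≤
      LinearMap.ker ((innerSL ℝ ν.1).coprod (innerSL ℝ ν.2)).toLinearMap := by
    refine sup_le ?_ ?_
    · rintro _ ⟨v, rfl⟩
      have := DFunLike.congr_fun h1 v
      rw [multDeriv_apply] at this
      simpa using this
    · rintro ⟨A, m⟩ ⟨hA, hm⟩
      have hm' : m = 0 := hm
      have := inner_eq_zero_of_mem_lineality h2 hA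
      simp [hm', this]
  rw [show _ = _ from hx, top_le_iff] at hle
  have h0 : ∀ w : Multiplier l s, inner ℝ ν.1 w.1 + inner ℝ ν.2 w.2 = 0 := fun w => by
    have : w ∈ LinearMap.ker ((innerSL ℝ ν.1).coprod (innerSL ℝ ν.2)).toLinearMap := by
      rw [hle]; trivial
    simpa using this
  have h3 := h0 (ν.1, 0)
  have h4 := h0 (0, ν.2)
  simp only [inner_zero_right, add_zero, zero_add, inner_self_eq_zero] at h3 h4
  exact Prod.ext h3 h4

theorem NondegenerateAt.multiplier_unique (hf : ContDiff ℝ 1 P.f) (hG : ContDiff ℝ 1 P.G)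
    (hh : ContDiff ℝ 1 P.h) {x : EuclideanSpace ℝ (Fin d)} (hx : P.NondegenerateAt x)
    {ν ν' : Multiplier l s} (h : P.eta x ν = 0) (h' : P.eta x ν' = 0) : ν = ν' := by
  have key : ∀ ν : Multiplier l s, P.eta x ν = 0 → fderiv ℝ P.f x + P.multDeriv x ν = 0 ∧
      (ν.1 : Matrix (Fin l) (Fin l) ℝ) * (P.G x : Matrix (Fin l) (Fin l) ℝ) = 0 := by
    intro ν hν
    rw [eta_eq hf hG hh, add_eq_zero_iff_of_nonneg (by positivity) (by positivity)] at hν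
    exact ⟨norm_eq_zero.mp ((pow_eq_zero_iff two_ne_zero).mp hν.1),
      norm_eq_zero.mp ((pow_eq_zero_iff two_ne_zero).mp hν.2)⟩
  obtain ⟨h1, h2⟩ := key ν h
  obtain ⟨h3, h4⟩ := key ν' h'
  refine sub_eq_zero.mp (hx.eq_zero ?_ ?_)
  · rw [multDeriv_sub, ← add_sub_add_left_eq_sub _ _ (fderiv ℝ P.f x), h1, h3, sub_zero]
  · rw [Prod.fst_sub, Submodule.coe_sub, sub_mul, h2, h4, sub_zero]

/-- Near a nondegenerate point, multipliers with bounded `η` are bounded. -/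
theorem NondegenerateAt.multiplier_bounded (hf : ContDiff ℝ 1 P.f) (hG : ContDiff ℝ 1 P.G)
    (hh : ContDiff ℝ 1 P.h) {x₀ : EuclideanSpace ℝ (Fin d)} (hx : P.NondegenerateAt x₀)
    (M : ℝ) : ∃ R : ℝ, ∀ᶠ x in 𝓝 x₀, ∀ ν : Multiplier l s, P.eta x ν ≤ M → ‖ν‖ ≤ R := by
  set Q : EuclideanSpace ℝ (Fin d) × Multiplier l s → ℝ := fun z => ‖P.multDeriv z.1 z.2‖ +
    ‖(z.2.1 : Matrix (Fin l) (Fin l) ℝ) * (P.G z.1 : Matrix (Fin l) (Fin l) ℝ)‖ with hQ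
  have hQc : Continuous Q := (continuous_multDeriv hG hh).norm.add (continuous_mul_G hG).norm
  have hsph : IsCompact (Metric.sphere (0 : Multiplier l s) 1) := isCompact_sphere _ _
  have hpos : ∀ ν ∈ Metric.sphere (0 : Multiplier l s) 1, 0 < Q (x₀, ν) := by
    intro ν hν
    refine lt_of_le_of_ne (by positivity) fun h0 => ?_
    have h0' := h0.symm
    simp only [hQ] at h0'
    rw [add_eq_zero_iff_of_nonneg (by positivity) (by positivity), norm_eq_zero,
      norm_eq_zero] at h0'
    have := hx.eq_zero h0'.1 h0'.2
    simp [this] at hν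
  obtain ⟨m, hm, hmQ⟩ : ∃ m : ℝ, 0 < m ∧
      ∀ ν ∈ Metric.sphere (0 : Multiplier l s) 1, m < Q (x₀, ν) := by
    -- The sphere is empty when the multiplier space is trivial (`l = s = 0`).
    rcases (Metric.sphere (0 : Multiplier l s) 1).eq_empty_or_nonempty with he | hne
    · exact ⟨1, one_pos, by simp [he]⟩
    · obtain ⟨ν₀, hν₀, hmin⟩ := hsph.exists_isMinOn hne
        (hQc.comp (Continuous.prodMk_right x₀)).continuousOn
      refine ⟨Q (x₀, ν₀) / 2, half_pos (hpos _ hν₀), fun ν hν => ?_⟩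
      exact (half_lt_self (hpos _ hν₀)).trans_le (hmin hν)
  have hev : ∀ᶠ x in 𝓝 x₀, ∀ ν ∈ Metric.sphere (0 : Multiplier l s) 1, m < Q (x, ν) :=
    hsph.eventually_forall_of_forall_eventually
      (P := fun x ν => m < Q (x, ν)) fun ν hν => hQc.continuousAt.eventually_const_lt (hmQ ν hν)
  have hfc : Continuous fun x => ‖fderiv ℝ P.f x‖ := (hf.continuous_fderiv one_ne_zero).norm
  have hfev : ∀ᶠ x in 𝓝 x₀, ‖fderiv ℝ P.f x‖ < ‖fderiv ℝ P.f x₀‖ + 1 :=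
    hfc.continuousAt.eventually_lt_const (lt_add_one _)
  refine ⟨(2 * √M + ‖fderiv ℝ P.f x₀‖ + 1) / m, ?_⟩
  filter_upwards [hev, hfev] with x h1 h2 ν hν
  -- `Q` is positively homogeneous of degree one in `ν`, so its bound on the sphere scales.
  have hQle : m * ‖ν‖ ≤ Q (x, ν) := by
    rcases eq_or_ne ν 0 with rfl | h0
    · simp only [norm_zero, mul_zero]
      positivity
    have hn : 0 < ‖ν‖ := norm_pos_iff.mpr h0
    have h3 := h1 (‖ν‖⁻¹ • ν) (by simp [norm_smul, hn.ne'])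
    have h4 : Q (x, ‖ν‖⁻¹ • ν) = ‖ν‖⁻¹ * Q (x, ν) := by
      simp only [hQ, multDeriv_smul, norm_smul, Prod.smul_fst, Submodule.coe_smul,
        Matrix.smul_mul, norm_inv, norm_norm]
      ring
    rw [h4, inv_mul_eq_div, lt_div_iff₀ hn] at h3
    exact h3.le
  rw [eta_eq hf hG hh] at hν
  have h5 : ‖fderiv ℝ P.f x + P.multDeriv x ν‖ ≤ √M := Real.le_sqrt_of_sq_le (by
    nlinarith [sq_nonneg ‖(ν.1 : Matrix (Fin l) (Fin l) ℝ) * (P.G x : Matrix (Fin l) (Fin l) ℝ)‖])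
  have h6 : ‖(ν.1 : Matrix (Fin l) (Fin l) ℝ) * (P.G x : Matrix (Fin l) (Fin l) ℝ)‖ ≤ √M :=
    Real.le_sqrt_of_sq_le (by nlinarith [sq_nonneg ‖fderiv ℝ P.f x + P.multDeriv x ν‖])
  have h7 : ‖P.multDeriv x ν‖ ≤
      ‖fderiv ℝ P.f x + P.multDeriv x ν‖ + ‖fderiv ℝ P.f x‖ := by
    have := norm_sub_le (fderiv ℝ P.f x + P.multDeriv x ν) (fderiv ℝ P.f x)
    rwa [add_sub_cancel_left] at this
  rw [le_div_iff₀ hm, mul_comm]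
  simp only [hQ] at hQle
  linarith

end SDProgram

namespace SDProgram

variable {d l s : ℕ} (P : SDProgram d l s)

/-! ### Existence of positive semidefinite multipliers, by the quadratic penalty method -/

/-- The squared constraint violation `‖[G(x)]₊‖² + ‖h(x)‖²`. -/
def violation (x : EuclideanSpace ℝ (Fin d)) : ℝ := ‖psdProj (P.G x)‖ ^ 2 + ‖P.h x‖ ^ 2

theorem violation_nonneg (x : EuclideanSpace ℝ (Fin d)) : 0 ≤ P.violation x := by
  unfold violation
  positivity

variable {P}

theorem continuous_violation (hG : ContDiff ℝ 1 P.G) (hh : ContDiff ℝ 1 P.h) :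
    Continuous P.violation :=
  (((continuous_norm_psdProj l).comp hG.continuous).pow 2).add (hh.continuous.norm.pow 2)

theorem violation_eq_zero {x : EuclideanSpace ℝ (Fin d)} (hx : x ∈ P.feasible) :
    P.violation x = 0 := by
  simp [violation, psdProj_eq_zero hx.1, hx.2]

theorem mem_feasible_of_violation {x : EuclideanSpace ℝ (Fin d)} (hx : P.violation x ≤ 0) :
    x ∈ P.feasible := by
  have h0 := le_antisymm hx (P.violation_nonneg x)
  rw [violation, add_eq_zero_iff_of_nonneg (by positivity) (by positivity),
    pow_eq_zero_iff two_ne_zero, pow_eq_zero_iff two_ne_zero] at h0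
  exact ⟨mem_nsdCone_of_norm_psdProj_eq_zero h0.1, norm_eq_zero.mp h0.2⟩

/-- With `W` frozen the penalty is smooth, so the projection need not be differentiated. -/
theorem stationary_of_isLocalMin_penalty (hf : ContDiff ℝ 1 P.f) (hG : ContDiff ℝ 1 P.G)
    (hh : ContDiff ℝ 1 P.h) {x₀ y : EuclideanSpace ℝ (Fin d)} {W : SymMat l} {t : ℝ}
    (hy : IsLocalMin (fun x => P.f x + t / 2 * (‖P.G x - W‖ ^ 2 + ‖P.h x‖ ^ 2) +
      1 / 2 * ‖x - x₀‖ ^ 2) y) :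
    fderiv ℝ P.f y + P.multDeriv y (t • (P.G y - W), t • P.h y) = -innerSL ℝ (y - x₀) := by
  have h1 := (hf.differentiable one_ne_zero y).hasFDerivAt
  have h2 := ((hG.differentiable one_ne_zero y).hasFDerivAt.sub_const W).norm_sq
  have h3 := (hh.differentiable one_ne_zero y).hasFDerivAt.norm_sq
  have h4 := ((hasFDerivAt_id (𝕜 := ℝ) y).sub_const x₀).norm_sq
  have h5 := (h1.add ((h2.add h3).const_mul (t / 2))).add (h4.const_mul (1 / 2))
  have h6 := hy.hasFDerivAt_eq_zero h5
  ext v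
  have h7 : fderiv ℝ P.f y v + t / 2 * (2 * inner ℝ (P.G y - W) (fderiv ℝ P.G y v) +
      2 * inner ℝ (P.h y) (fderiv ℝ P.h y v)) + 1 / 2 * (2 * inner ℝ (y - x₀) v) = 0 := by
    have h7 := DFunLike.congr_fun h6 v
    simp only [add_apply, smul_apply, ContinuousLinearMap.comp_apply, innerSL_apply_apply,
      zero_apply, smul_eq_mul, nsmul_eq_mul, Nat.cast_ofNat, ContinuousLinearMap.id_apply,
      id_eq] at h7
    exact h7
  have h8 := real_inner_smul_left (P.G y - W) (fderiv ℝ P.G y v) t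
  have h9 := real_inner_smul_left (P.h y) (fderiv ℝ P.h y v) t
  rw [add_apply, multDeriv_apply, h8, h9, neg_apply, innerSL_apply_apply]
  linarith

theorem tendsto_eta (hf : ContDiff ℝ 1 P.f) (hG : ContDiff ℝ 1 P.G) (hh : ContDiff ℝ 1 P.h)
    {x : ℕ → EuclideanSpace ℝ (Fin d)} {ν : ℕ → Multiplier l s}
    {x₀ : EuclideanSpace ℝ (Fin d)} {ν₀ : Multiplier l s}
    (hx : Tendsto x atTop (𝓝 x₀)) (hν : Tendsto ν atTop (𝓝 ν₀)) :
    Tendsto (fun n => P.eta (x n) (ν n)) atTop (𝓝 (P.eta x₀ ν₀)) := by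
  have h1 := (continuous_eta hf hG hh).tendsto (x₀, ν₀)
  have h2 := h1.comp (hx.prodMk_nhds hν)
  exact h2

theorem NondegenerateAt.exists_subseq_multiplier (hf : ContDiff ℝ 1 P.f)
    (hG : ContDiff ℝ 1 P.G) (hh : ContDiff ℝ 1 P.h) {x₀ : EuclideanSpace ℝ (Fin d)}
    (hnd : P.NondegenerateAt x₀) {x : ℕ → EuclideanSpace ℝ (Fin d)} {ν : ℕ → Multiplier l s}
    {M : ℝ} (hx : Tendsto x atTop (𝓝 x₀)) (hη : ∀ᶠ n in atTop, P.eta (x n) (ν n) ≤ M) :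
    ∃ (ν₀ : Multiplier l s) (ψ : ℕ → ℕ), StrictMono ψ ∧
      Tendsto (fun n => ν (ψ n)) atTop (𝓝 ν₀) := by
  obtain ⟨R, hR⟩ := hnd.multiplier_bounded hf hG hh M
  have hbdd : ∀ᶠ n in atTop, ν n ∈ Metric.closedBall (0 : Multiplier l s) R := by
    filter_upwards [hx.eventually hR, hη] with n h1 h2
    rw [mem_closedBall_zero_iff]
    exact h1 _ h2
  obtain ⟨ν₀, -, ψ, hψ, hνlim⟩ := (isCompact_closedBall (0 : Multiplier l s) R).tendsto_subseq'
    hbdd.frequently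
  exact ⟨ν₀, ψ, hψ, hνlim⟩

/-- Minimizers of the penalized objective on a ball, with a proximal term selecting `x₀`, yield
approximate multipliers `n [G]₊` and `n h`. Nondegeneracy makes them converge along a subsequence,
and semidefiniteness survives the limit. -/
theorem exists_psd_multiplier (hf : ContDiff ℝ 1 P.f) (hG : ContDiff ℝ 1 P.G)
    (hh : ContDiff ℝ 1 P.h) {x₀ : EuclideanSpace ℝ (Fin d)} (hx₀ : x₀ ∈ P.globalSol)
    (hnd : P.NondegenerateAt x₀) :
    ∃ ν : Multiplier l s, P.eta x₀ ν = 0 ∧ ν.1 ∈ psdCone l := by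
  have hV := continuous_violation hG hh
  have hcpt : IsCompact (Metric.closedBall x₀ 1) := isCompact_closedBall _ _
  have hne : (Metric.closedBall x₀ 1).Nonempty := ⟨x₀, Metric.mem_closedBall_self zero_le_one⟩
  have hex : ∀ n : ℕ, ∃ y ∈ Metric.closedBall x₀ 1, ∀ z ∈ Metric.closedBall x₀ 1,
      P.f y + n / 2 * P.violation y + 1 / 2 * ‖y - x₀‖ ^ 2 ≤
        P.f z + n / 2 * P.violation z + 1 / 2 * ‖z - x₀‖ ^ 2 := fun n => by
    have hc : Continuous fun y => P.f y + n / 2 * P.violation y + 1 / 2 * ‖y - x₀‖ ^ 2 := by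
      have := hf.continuous
      fun_prop
    obtain ⟨y, hy, hmin⟩ := hcpt.exists_isMinOn hne hc.continuousOn
    exact ⟨y, hy, fun z hz => hmin hz⟩
  choose x hxmem hxmin using hex
  have hval : ∀ n : ℕ, P.f (x n) + n / 2 * P.violation (x n) + 1 / 2 * ‖x n - x₀‖ ^ 2 ≤ P.f x₀ := by
    intro n
    have := hxmin n x₀ (Metric.mem_closedBall_self zero_le_one)
    simpa [violation_eq_zero hx₀.1] using this
  have hnV : ∀ n : ℕ, 0 ≤ (n : ℝ) / 2 * P.violation (x n) := fun n =>
    mul_nonneg (by positivity) (P.violation_nonneg _)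
  -- the penalty minimizers accumulate at `x₀`
  obtain ⟨y, -, φ, hφ, hlim⟩ := hcpt.tendsto_subseq hxmem
  -- The lower bound `f z` on the ball makes the violation at most `2 (f x₀ - f z) / n`.
  obtain ⟨z, -, hz⟩ := hcpt.exists_isMinOn hne hf.continuous.continuousOn
  have hflim : Tendsto (fun n => P.f (x (φ n))) atTop (𝓝 (P.f y)) :=
    (hf.continuous.tendsto y).comp hlim
  have hdlim : Tendsto (fun n => 1 / 2 * ‖x (φ n) - x₀‖ ^ 2) atTop (𝓝 (1 / 2 * ‖y - x₀‖ ^ 2)) :=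
    ((hlim.sub_const x₀).norm.pow 2).const_mul _
  have hyfeas : y ∈ P.feasible := by
    refine mem_feasible_of_violation (le_of_tendsto_of_tendsto ((hV.tendsto y).comp hlim)
      ((tendsto_const_div_atTop_nhds_zero_nat (2 * (P.f x₀ - P.f z))).comp hφ.tendsto_atTop) ?_)
    filter_upwards [hφ.tendsto_atTop.eventually_gt_atTop 0] with n hn
    have hn' : (0 : ℝ) < φ n := by exact_mod_cast hn
    have h1 : P.f z ≤ P.f (x (φ n)) := hz (hxmem _)
    simp only [Function.comp_apply]
    rw [le_div_iff₀ hn']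
    nlinarith [hval (φ n), sq_nonneg ‖x (φ n) - x₀‖]
  have hyx : y = x₀ := by
    have h1 : P.f y + 1 / 2 * ‖y - x₀‖ ^ 2 ≤ P.f x₀ :=
      le_of_tendsto (hflim.add hdlim) (Eventually.of_forall fun n => by
        linarith [hval (φ n), hnV (φ n)])
    have h2 := hx₀.2 y hyfeas
    have h3 : ‖y - x₀‖ ^ 2 = 0 := le_antisymm (by linarith) (sq_nonneg _)
    exact sub_eq_zero.mp (norm_eq_zero.mp ((pow_eq_zero_iff two_ne_zero).mp h3))
  subst hyx
  have hVlim : Tendsto (fun n => (φ n : ℝ) * P.violation (x (φ n))) atTop (𝓝 0) := by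
    have h1 : Tendsto (fun n => 2 * (P.f y - P.f (x (φ n)))) atTop (𝓝 0) := by
      simpa using (hflim.const_sub (P.f y)).const_mul 2
    refine squeeze_zero (fun n => by linarith [hnV (φ n)]) (fun n => ?_) h1
    linarith [hval (φ n), sq_nonneg ‖x (φ n) - y‖]
  -- the associated multipliers make `η` vanish in the limit
  set ν : ℕ → Multiplier l s := fun n =>
    ((φ n : ℝ) • psdProj (P.G (x (φ n))), (φ n : ℝ) • P.h (x (φ n))) with hν
  have hηlim : Tendsto (fun n => P.eta (x (φ n)) (ν n)) atTop (𝓝 0) := by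
    -- This dominates `η`: stationarity leaves only the proximal gradient, and `[G]₊ G = [G]₊²`
    -- bounds the complementarity term.
    have h1 : Tendsto (fun n => ‖x (φ n) - y‖ ^ 2 + ((φ n : ℝ) * P.violation (x (φ n))) ^ 2)
        atTop (𝓝 0) := by
      simpa using ((hlim.sub_const y).norm.pow 2).add (hVlim.pow 2)
    have hball : ∀ᶠ n in atTop, x (φ n) ∈ Metric.ball y 1 :=
      hlim (Metric.ball_mem_nhds y one_pos)
    refine squeeze_zero' (Eventually.of_forall fun n => eta_nonneg hf hG hh _ _) ?_ h1
    filter_upwards [hball] with n hn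
    have hW := sub_psdProj_mem_nsdCone (P.G (x (φ n)))
    -- Freezing the negative part of `G` at the minimizer gives a smooth majorant of the penalty
    -- that agrees with it there, so the minimum persists.
    have hmin : IsLocalMin (fun w => P.f w + (φ n : ℝ) / 2 *
        (‖P.G w - (P.G (x (φ n)) - psdProj (P.G (x (φ n))))‖ ^ 2 + ‖P.h w‖ ^ 2) +
        1 / 2 * ‖w - y‖ ^ 2) (x (φ n)) := by
      filter_upwards [Metric.isOpen_ball.mem_nhds hn] with w hw
      have h2 := hxmin (φ n) w (Metric.ball_subset_closedBall hw)
      have h3 : P.violation w ≤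
          ‖P.G w - (P.G (x (φ n)) - psdProj (P.G (x (φ n))))‖ ^ 2 + ‖P.h w‖ ^ 2 := by
        have := norm_psdProj_le (P.G w) _ hW
        unfold violation
        gcongr
      have h4 := mul_le_mul_of_nonneg_left h3 (show (0 : ℝ) ≤ (φ n : ℝ) / 2 by positivity)
      rw [sub_sub_cancel]
      unfold violation at h2 h4
      linarith
    have h5 := stationary_of_isLocalMin_penalty hf hG hh hmin
    rw [sub_sub_cancel] at h5
    have h6 : ‖((ν n).1 : Matrix (Fin l) (Fin l) ℝ) *
        (P.G (x (φ n)) : Matrix (Fin l) (Fin l) ℝ)‖ ≤ (φ n : ℝ) * P.violation (x (φ n)) := by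
      simp only [hν, Submodule.coe_smul, Matrix.smul_mul, psdProj_mul_self, norm_smul,
        Real.norm_natCast]
      refine mul_le_mul_of_nonneg_left ?_ (by positivity)
      refine (Matrix.frobenius_norm_mul _ _).trans ?_
      unfold violation
      rw [← sq]
      exact le_add_of_nonneg_right (sq_nonneg _)
    rw [eta_eq hf hG hh, h5, norm_neg, innerSL_apply_norm]
    gcongr
  obtain ⟨ν₀, ψ, hψ, hνlim⟩ := hnd.exists_subseq_multiplier hf hG hh hlim
    (hηlim.eventually_le_const one_pos)
  refine ⟨ν₀, ?_, ?_⟩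
  · exact tendsto_nhds_unique
      (tendsto_eta hf hG hh (hlim.comp hψ.tendsto_atTop) hνlim) (hηlim.comp hψ.tendsto_atTop)
  · have h1 : Tendsto (fun n => (ν (ψ n)).1) atTop (𝓝 ν₀.1) :=
      (continuous_fst.tendsto ν₀).comp hνlim
    refine (isClosed_psdCone l).mem_of_tendsto h1 (Eventually.of_forall fun n => ?_)
    exact smul_mem_psdCone (psdProj_mem _) (Nat.cast_nonneg _)

end SDProgram

/-! ### Bounds for the augmented Lagrangian -/

/-- Half of the quadratic term absorbs the inner product by completing the square, at cost `p ‖u‖² /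
c`; the other half remains. -/
theorem quadratic_lower_bound {E : Type*} [NormedAddCommGroup E] [InnerProductSpace ℝ E] (u v : E)
    {p c α : ℝ} (hp : 0 < p) (hpα : p ≤ α) (hu : p * ‖u‖ ^ 2 ≤ α) (hc : 0 < c) :
    c / (4 * α) * ‖v‖ ^ 2 - α / c ≤ inner ℝ u v + c / (2 * p) * ‖v‖ ^ 2 := by
  have h1 : -(‖u‖ * ‖v‖) ≤ inner ℝ u v := neg_le_of_abs_le (abs_real_inner_le_norm u v)
  have h2 : 0 ≤ p / c * (‖u‖ - c / (2 * p) * ‖v‖) ^ 2 := by positivity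
  have h3 : p / c * (‖u‖ - c / (2 * p) * ‖v‖) ^ 2 =
      p * ‖u‖ ^ 2 / c - ‖u‖ * ‖v‖ + (c / (2 * p) * ‖v‖ ^ 2 - c / (4 * p) * ‖v‖ ^ 2) := by
    field_simp
    ring
  have h4 : p * ‖u‖ ^ 2 / c ≤ α / c := by gcongr
  have h5 : c / (4 * α) * ‖v‖ ^ 2 ≤ c / (4 * p) * ‖v‖ ^ 2 := by gcongr
  linarith

/-- The projection norm is the distance to the negative semidefinite cone, and `c (A - Y)` is a
competitor at distance `‖c Y + p lam‖`. -/
theorem psdProj_penalty_le {l : ℕ} (A lam Y : SymMat l) {p c : ℝ} (hp : 0 < p) (hc : 0 < c)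
    (hY : A - Y ∈ nsdCone l) :
    1 / (2 * c * p) * (trInner (psdProj (c • A + p • lam)) (psdProj (c • A + p • lam)) -
      p ^ 2 * trInner lam lam) ≤ inner ℝ lam Y + c / (2 * p) * ‖Y‖ ^ 2 := by
  have hW : c • (A - Y) ∈ nsdCone l := by
    have := smul_mem_psdCone hY hc.le
    rwa [smul_neg] at this
  have h1 := norm_psdProj_le (c • A + p • lam) _ hW
  have h2 : c • A + p • lam - c • (A - Y) = c • Y + p • lam := by module
  rw [h2] at h1
  have h3 : ‖c • Y + p • lam‖ ^ 2 = c ^ 2 * ‖Y‖ ^ 2 + 2 * (c * p * inner ℝ lam Y) +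
      p ^ 2 * ‖lam‖ ^ 2 := by
    have h4 : inner ℝ (c • Y) (p • lam) = c * (p * inner ℝ lam Y) := by
      have h5 := real_inner_smul_left Y (p • lam) c
      have h6 := real_inner_smul_right Y lam p
      rw [h5, h6, real_inner_comm]
    rw [norm_add_sq_real, h4, norm_smul, norm_smul, mul_pow, mul_pow, Real.norm_eq_abs,
      Real.norm_eq_abs, sq_abs, sq_abs]
    ring
  have h5 : ‖psdProj (c • A + p • lam)‖ ^ 2 ≤ ‖c • Y + p • lam‖ ^ 2 := by gcongr
  rw [h3] at h5
  rw [trInner_self, trInner_self]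
  calc _ ≤ 1 / (2 * c * p) * (c ^ 2 * ‖Y‖ ^ 2 + 2 * (c * p * inner ℝ lam Y)) := by
        gcongr
        linarith
    _ = _ := by
        field_simp
        ring

theorem exists_psdProj_penalty_eq {l : ℕ} (A lam : SymMat l) {p c : ℝ} (hp : 0 < p) (hc : 0 < c) :
    ∃ Y : SymMat l, A - Y ∈ nsdCone l ∧
    1 / (2 * c * p) * (trInner (psdProj (c • A + p • lam)) (psdProj (c • A + p • lam)) -
      p ^ 2 * trInner lam lam) = inner ℝ lam Y + c / (2 * p) * ‖Y‖ ^ 2 := by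
  set Z := psdProj (c • A + p • lam) with hZ
  -- The minimizing `Y` solves `c Y + p lam = Z`, which makes the competitor optimal.
  refine ⟨c⁻¹ • (Z - p • lam), ?_, ?_⟩
  · have h1 := smul_mem_psdCone (psdProj_sub_self_mem (c • A + p • lam)) (inv_nonneg.mpr hc.le)
    have h2 : -(A - c⁻¹ • (Z - p • lam)) = c⁻¹ • (Z - (c • A + p • lam)) := by
      rw [← sub_sub, sub_right_comm, smul_sub c⁻¹ _ (c • A), inv_smul_smul₀ hc.ne']
      abel
    rwa [nsdCone, mem_ofPred_eq, h2]
  · have h1 : inner ℝ lam (c⁻¹ • (Z - p • lam)) =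
        c⁻¹ * (inner ℝ lam Z - p * ‖lam‖ ^ 2) := by
      rw [← real_inner_self_eq_norm_sq, ← real_inner_smul_right, ← inner_sub_right,
        ← real_inner_smul_right]
    have h2 : ‖c⁻¹ • (Z - p • lam)‖ ^ 2 =
        (c⁻¹) ^ 2 * (‖Z‖ ^ 2 - 2 * (p * inner ℝ lam Z) + p ^ 2 * ‖lam‖ ^ 2) := by
      have h3 : inner ℝ Z (p • lam) = p * inner ℝ lam Z := by
        have h4 := real_inner_smul_right Z lam p
        rw [h4, real_inner_comm]
      rw [norm_smul, mul_pow, norm_sub_sq_real, h3, norm_smul, mul_pow, Real.norm_eq_abs,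
        Real.norm_eq_abs, sq_abs, sq_abs]
    rw [h1, h2, trInner_self, trInner_self]
    field_simp
    ring

namespace SDProgram

variable {d l s : ℕ} {P : SDProgram d l s} {α κ : ℝ}

theorem aFun_le (x : EuclideanSpace ℝ (Fin d)) : P.aFun α κ x ≤ α := by
  have : 0 ≤ trInner (psdProj (P.G x)) (psdProj (P.G x)) ^ κ :=
    Real.rpow_nonneg (by rw [trInner_self]; positivity) _
  unfold aFun
  linarith

theorem bFun_le (x : EuclideanSpace ℝ (Fin d)) : P.bFun α x ≤ α := by
  unfold bFun
  linarith [sq_nonneg ‖P.h x‖]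

theorem aFun_of_feasible (hκ : κ ≠ 0) {x : EuclideanSpace ℝ (Fin d)} (hx : x ∈ P.feasible) :
    P.aFun α κ x = α := by
  rw [aFun, psdProj_eq_zero hx.1, trInner_self, norm_zero, zero_pow two_ne_zero,
    Real.zero_rpow hκ, sub_zero]

theorem bFun_of_feasible {x : EuclideanSpace ℝ (Fin d)} (hx : x ∈ P.feasible) :
    P.bFun α x = α := by
  rw [bFun, hx.2, norm_zero, zero_pow two_ne_zero, sub_zero]

/-- The denominator in `p` and `q` makes the bounds required by `quadratic_lower_bound` uniform in
the multipliers. -/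
theorem div_one_add_bounds {a t α : ℝ} (ha : 0 < a) (haα : a ≤ α) (ht : 0 ≤ t) :
    0 < a / (1 + t) ∧ a / (1 + t) ≤ α ∧ a / (1 + t) * t ≤ α := by
  have h1 : 0 < 1 + t := by linarith
  refine ⟨by positivity, (div_le_self ha.le (by linarith)).trans haα, ?_⟩
  rw [div_mul_eq_mul_div, div_le_iff₀ h1]
  nlinarith

theorem pFun_bounds {x : EuclideanSpace ℝ (Fin d)} (hx : 0 < P.aFun α κ x) (lam : SymMat l) :
    0 < P.pFun α κ x lam ∧ P.pFun α κ x lam ≤ α ∧ P.pFun α κ x lam * ‖lam‖ ^ 2 ≤ α := by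
  rw [pFun, trInner_self]
  exact div_one_add_bounds hx (aFun_le x) (sq_nonneg _)

theorem qFun_bounds {x : EuclideanSpace ℝ (Fin d)} (hx : 0 < P.bFun α x)
    (μ : EuclideanSpace ℝ (Fin s)) :
    0 < P.qFun α x μ ∧ P.qFun α x μ ≤ α ∧ P.qFun α x μ * ‖μ‖ ^ 2 ≤ α :=
  div_one_add_bounds hx (bFun_le x) (sq_nonneg _)

theorem augLagFinite_le {x : EuclideanSpace ℝ (Fin d)} (ν : Multiplier l s) {c : ℝ} (hc : 0 < c)
    (ha : 0 < P.aFun α κ x) {Y : SymMat l} (hY : P.G x - Y ∈ nsdCone l) :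
    P.augLagFinite α κ x ν c ≤
      P.f x + (inner ℝ ν.1 Y + c / (2 * P.pFun α κ x ν.1) * ‖Y‖ ^ 2) +
        inner ℝ ν.2 (P.h x) + c / (2 * P.qFun α x ν.2) * ‖P.h x‖ ^ 2 + P.eta x ν := by
  have := psdProj_penalty_le (P.G x) ν.1 Y (pFun_bounds ha ν.1).1 hc hY
  unfold augLagFinite
  gcongr

theorem exists_augLagFinite_eq {x : EuclideanSpace ℝ (Fin d)} (ν : Multiplier l s) {c : ℝ}
    (hc : 0 < c) (ha : 0 < P.aFun α κ x) :
    ∃ Y : SymMat l, P.G x - Y ∈ nsdCone l ∧ P.augLagFinite α κ x ν c =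
      P.f x + (inner ℝ ν.1 Y + c / (2 * P.pFun α κ x ν.1) * ‖Y‖ ^ 2) +
        inner ℝ ν.2 (P.h x) + c / (2 * P.qFun α x ν.2) * ‖P.h x‖ ^ 2 + P.eta x ν := by
  obtain ⟨Y, hY, hYeq⟩ := exists_psdProj_penalty_eq (P.G x) ν.1 (pFun_bounds ha ν.1).1 hc
  exact ⟨Y, hY, by rw [augLagFinite, hYeq]⟩

theorem augLagFinite_lower_bound {x : EuclideanSpace ℝ (Fin d)} (ν : Multiplier l s) {c : ℝ}
    (hc : 0 < c) (ha : 0 < P.aFun α κ x) (hb : 0 < P.bFun α x) :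
    P.f x + c / (4 * α) * P.violation x - 2 * α / c + P.eta x ν ≤ P.augLagFinite α κ x ν c := by
  obtain ⟨Y, hY, hYeq⟩ := exists_augLagFinite_eq (P := P) ν hc ha
  obtain ⟨hp, hpα, hpu⟩ := pFun_bounds ha ν.1
  obtain ⟨hq, hqα, hqu⟩ := qFun_bounds hb ν.2
  have hα : 0 < α := hp.trans_le hpα
  have h1 := quadratic_lower_bound ν.1 Y hp hpα hpu hc
  have h2 := quadratic_lower_bound ν.2 (P.h x) hq hqα hqu hc
  have h3 : ‖psdProj (P.G x)‖ ≤ ‖Y‖ := by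
    have := norm_psdProj_le (P.G x) _ hY
    rwa [sub_sub_cancel] at this
  have h4 : c / (4 * α) * ‖psdProj (P.G x)‖ ^ 2 ≤ c / (4 * α) * ‖Y‖ ^ 2 := by gcongr
  have h5 : 2 * α / c = α / c + α / c := by ring
  rw [hYeq, violation, mul_add, h5]
  linarith

/-- Monotonicity in the penalty parameter, with the gain made explicit. -/
theorem exists_augLagFinite_add_le {x : EuclideanSpace ℝ (Fin d)} (ν : Multiplier l s) {c c' : ℝ}
    (hc : 0 < c) (hcc' : c ≤ c') (ha : 0 < P.aFun α κ x) :
    ∃ Y : SymMat l, P.G x - Y ∈ nsdCone l ∧ P.augLagFinite α κ x ν c' =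
      P.f x + (inner ℝ ν.1 Y + c' / (2 * P.pFun α κ x ν.1) * ‖Y‖ ^ 2) +
        inner ℝ ν.2 (P.h x) + c' / (2 * P.qFun α x ν.2) * ‖P.h x‖ ^ 2 + P.eta x ν ∧
      P.augLagFinite α κ x ν c + ((c' - c) / (2 * P.pFun α κ x ν.1) * ‖Y‖ ^ 2 +
        (c' - c) / (2 * P.qFun α x ν.2) * ‖P.h x‖ ^ 2) ≤ P.augLagFinite α κ x ν c' := by
  obtain ⟨Y, hY, hYeq⟩ := exists_augLagFinite_eq (P := P) ν (hc.trans_le hcc') ha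
  refine ⟨Y, hY, hYeq, ?_⟩
  -- The minimizer `Y` for `c'` is a competitor for `c`; only the quadratic terms change.
  have h1 := augLagFinite_le (P := P) ν hc ha hY
  rw [hYeq, sub_div, sub_div]
  linarith

theorem augLagFinite_mono {x : EuclideanSpace ℝ (Fin d)} (ν : Multiplier l s) {c c' : ℝ}
    (hc : 0 < c) (hcc' : c ≤ c') (ha : 0 < P.aFun α κ x) (hb : 0 < P.bFun α x) :
    P.augLagFinite α κ x ν c ≤ P.augLagFinite α κ x ν c' := by
  obtain ⟨Y, -, -, h⟩ := exists_augLagFinite_add_le (P := P) ν hc hcc' ha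
  have hp := (pFun_bounds ha ν.1).1
  have hq := (qFun_bounds hb ν.2).1
  have hcc := sub_nonneg.mpr hcc'
  refine le_trans (le_add_of_nonneg_right ?_) h
  positivity

theorem augLag_eq {x : EuclideanSpace ℝ (Fin d)} (ha : 0 < P.aFun α κ x) (hb : 0 < P.bFun α x)
    (ν : Multiplier l s) (c : ℝ) : P.augLag α κ x ν c = (P.augLagFinite α κ x ν c : EReal) :=
  if_pos ⟨ha, hb⟩

theorem augLag_cases (x : EuclideanSpace ℝ (Fin d)) :
    (0 < P.aFun α κ x ∧ 0 < P.bFun α x) ∨ ∀ ν c, P.augLag α κ x ν c = ⊤ := by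
  by_cases h : 0 < P.aFun α κ x ∧ 0 < P.bFun α x
  · exact Or.inl h
  · exact Or.inr fun ν c => if_neg h

theorem augLag_mono (x : EuclideanSpace ℝ (Fin d)) (ν : Multiplier l s) {c c' : ℝ}
    (hc : 0 < c) (hcc' : c ≤ c') : P.augLag α κ x ν c ≤ P.augLag α κ x ν c' := by
  rcases P.augLag_cases (α := α) (κ := κ) x with ⟨ha, hb⟩ | htop
  · rw [augLag_eq ha hb, augLag_eq ha hb]
    exact EReal.coe_le_coe_iff.mpr (augLagFinite_mono ν hc hcc' ha hb)
  · rw [htop, htop]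

/-- The lower bound at points where the augmented Lagrangian is below `t`. -/
theorem bound_of_augLag_lt {x : EuclideanSpace ℝ (Fin d)} {ν : Multiplier l s} {c t : ℝ}
    (hc : 0 < c) (h : P.augLag α κ x ν c < (t : EReal)) :
    0 < P.aFun α κ x ∧ 0 < P.bFun α x ∧
      P.f x + c / (4 * α) * P.violation x - 2 * α / c + P.eta x ν < t := by
  rcases P.augLag_cases (α := α) (κ := κ) x with ⟨ha, hb⟩ | htop
  · rw [augLag_eq ha hb] at h
    exact ⟨ha, hb, (augLagFinite_lower_bound ν hc ha hb).trans_lt (EReal.coe_lt_coe_iff.mp h)⟩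
  · rw [htop] at h
    exact absurd h not_top_lt

/-- At a feasible point with a positive semidefinite multiplier at which `η` vanishes, the augmented
Lagrangian coincides with the objective function. -/
theorem augLag_eq_of_multiplier (hf : ContDiff ℝ 1 P.f) (hG : ContDiff ℝ 1 P.G)
    (hh : ContDiff ℝ 1 P.h) (hα : 0 < α) (hκ : 1 ≤ κ) {x : EuclideanSpace ℝ (Fin d)}
    (hx : x ∈ P.feasible) {ν : Multiplier l s} (hη : P.eta x ν = 0) (hν : ν.1 ∈ psdCone l)
    {c : ℝ} (hc : 0 < c) : P.augLag α κ x ν c = (P.f x : EReal) := by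
  have ha : 0 < P.aFun α κ x := by rwa [aFun_of_feasible (by linarith) hx]
  have hb : 0 < P.bFun α x := by rwa [bFun_of_feasible hx]
  rw [augLag_eq ha hb, EReal.coe_eq_coe_iff]
  have hp := (pFun_bounds ha ν.1).1
  refine le_antisymm ?_ ?_
  · have := augLagFinite_le (P := P) ν hc ha (Y := 0) (by simpa using hx.1)
    simpa [hη, hx.2] using this
  · obtain ⟨Y, hY, hYeq⟩ := exists_augLagFinite_eq (P := P) ν hc ha
    have h0 : inner ℝ ν.1 (P.G x) = 0 := by
      rw [eta_eq hf hG hh, add_eq_zero_iff_of_nonneg (by positivity) (by positivity)] at hη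
      rw [inner_eq_trInner, trInner, norm_eq_zero.mp ((pow_eq_zero_iff two_ne_zero).mp hη.2),
        Matrix.trace_zero]
    -- `⟨lam, Y⟩ ≥ ⟨lam, G x⟩ = 0`: the only place where the sign of the multiplier matters.
    have h1 := trInner_nonneg_of_psd hν hY
    rw [← inner_eq_trInner, inner_neg_right, inner_sub_right, h0] at h1
    have h2 : 0 ≤ c / (2 * P.pFun α κ x ν.1) * ‖Y‖ ^ 2 := by positivity
    rw [hYeq, hη, hx.2, inner_zero_right, norm_zero]
    linarith

end SDProgram

/-! ### The localization principle -/

namespace SDProgram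

variable {d l s : ℕ} {P : SDProgram d l s} {α κ fstar : ℝ}

theorem eq_of_mem_globalSol (hfstar : IsLeast (P.f '' P.feasible) fstar)
    {x : EuclideanSpace ℝ (Fin d)} (hx : x ∈ P.globalSol) : P.f x = fstar := by
  obtain ⟨y, hy, hyf⟩ := hfstar.1
  exact le_antisymm (hyf ▸ hx.2 y hy) (hfstar.2 ⟨x, hx.1, rfl⟩)

theorem mem_globalSol_of_le (hfstar : IsLeast (P.f '' P.feasible) fstar)
    {x : EuclideanSpace ℝ (Fin d)} (hx : x ∈ P.feasible) (hle : P.f x ≤ fstar) :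
    x ∈ P.globalSol :=
  ⟨hx, fun y hy => hle.trans (hfstar.2 ⟨y, hy, rfl⟩)⟩

theorem globalSol_nonempty (hfstar : IsLeast (P.f '' P.feasible) fstar) :
    P.globalSol.Nonempty := by
  obtain ⟨x, hx, hxf⟩ := hfstar.1
  exact ⟨x, mem_globalSol_of_le hfstar hx hxf.le⟩

/-- Uniqueness identifies an arbitrary zero of `η` with the positive semidefinite multiplier. -/
theorem augLag_eq_optimalValue (hf : ContDiff ℝ 1 P.f) (hG : ContDiff ℝ 1 P.G)
    (hh : ContDiff ℝ 1 P.h) (hα : 0 < α) (hκ : 1 ≤ κ)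
    (hfstar : IsLeast (P.f '' P.feasible) fstar) {x : EuclideanSpace ℝ (Fin d)}
    (hx : x ∈ P.globalSol) (hnd : P.NondegenerateAt x) {ν : Multiplier l s}
    (hη : P.eta x ν = 0) {c : ℝ} (hc : 0 < c) : P.augLag α κ x ν c = (fstar : EReal) := by
  obtain ⟨ν', hη', hpsd⟩ := exists_psd_multiplier hf hG hh hx hnd
  obtain rfl := hnd.multiplier_unique hf hG hh hη hη'
  rw [augLag_eq_of_multiplier hf hG hh hα hκ hx.1 hη hpsd hc, eq_of_mem_globalSol hfstar hx]

/-- Points with bounded `x` at which the augmented Lagrangian lies below the optimal value for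
arbitrarily large penalty parameters accumulate at an optimal solution and its multiplier. -/
theorem exists_limit_of_augLag_lt (hf : ContDiff ℝ 1 P.f) (hG : ContDiff ℝ 1 P.G)
    (hh : ContDiff ℝ 1 P.h) (hα : 0 < α) (hfstar : IsLeast (P.f '' P.feasible) fstar)
    (hnd : ∀ x ∈ P.globalSol, P.NondegenerateAt x) {R : ℝ} {c : ℕ → ℝ}
    {x : ℕ → EuclideanSpace ℝ (Fin d)} {ν : ℕ → Multiplier l s} (hc1 : ∀ n, 1 ≤ c n)
    (hc : Tendsto c atTop atTop) (hR : ∀ n, ‖x n‖ ≤ R)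
    (hlt : ∀ n, P.augLag α κ (x n) (ν n) (c n) < (fstar : EReal)) :
    ∃ x₀ ∈ P.globalSol, ∃ ν₀, P.eta x₀ ν₀ = 0 ∧ ∃ φ : ℕ → ℕ, StrictMono φ ∧
      Tendsto (fun n => x (φ n)) atTop (𝓝 x₀) ∧ Tendsto (fun n => ν (φ n)) atTop (𝓝 ν₀) := by
  have hc0 : ∀ n, 0 < c n := fun n => one_pos.trans_le (hc1 n)
  have hbd := fun n => (bound_of_augLag_lt (hc0 n) (hlt n)).2.2
  have hη0 := fun n => eta_nonneg hf hG hh (x n) (ν n)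
  have hV0 : ∀ n, 0 ≤ c n / (4 * α) * P.violation (x n) := fun n =>
    mul_nonneg (div_nonneg (hc0 n).le (by positivity)) (P.violation_nonneg _)
  have hαc : ∀ n, 2 * α / c n ≤ 2 * α := fun n => div_le_self (by positivity) (hc1 n)
  have hxmem : ∀ n, x n ∈ Metric.closedBall (0 : EuclideanSpace ℝ (Fin d)) R := fun n => by
    simpa using hR n
  have hcpt := isCompact_closedBall (0 : EuclideanSpace ℝ (Fin d)) R
  obtain ⟨x₀, -, φ, hφ, hxlim⟩ := hcpt.tendsto_subseq hxmem
  obtain ⟨z, -, hz⟩ := hcpt.exists_isMinOn ⟨x 0, hxmem 0⟩ hf.continuous.continuousOn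
  have hm : ∀ n, P.f z ≤ P.f (x n) := fun n => hz (hxmem n)
  have hclim : Tendsto (fun n => 2 * α / c n) atTop (𝓝 0) := hc.const_div_atTop _
  have hxfeas : x₀ ∈ P.feasible := by
    have h1 : Tendsto (fun n => 4 * α * (fstar - P.f z + 2 * α) / c n) atTop (𝓝 0) :=
      hc.const_div_atTop _
    have h2 : Tendsto (fun n => P.violation (x (φ n))) atTop (𝓝 (P.violation x₀)) :=
      ((continuous_violation hG hh).tendsto x₀).comp hxlim
    refine mem_feasible_of_violation
      (le_of_tendsto_of_tendsto' h2 (h1.comp hφ.tendsto_atTop) fun n => ?_)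
    have h3 : c (φ n) / (4 * α) * P.violation (x (φ n)) ≤ fstar - P.f z + 2 * α := by
      linarith [hbd (φ n), hm (φ n), hη0 (φ n), hαc (φ n)]
    rw [div_mul_eq_mul_div, div_le_iff₀ (by positivity)] at h3
    simp only [Function.comp_apply]
    rw [le_div_iff₀ (hc0 _)]
    linarith
  have hflim : Tendsto (fun n => P.f (x (φ n))) atTop (𝓝 (P.f x₀)) :=
    (hf.continuous.tendsto x₀).comp hxlim
  have hubd : Tendsto (fun n => fstar + 2 * α / c (φ n)) atTop (𝓝 fstar) := by
    simpa using (hclim.comp hφ.tendsto_atTop).const_add fstar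
  have hx₀ : x₀ ∈ P.globalSol := by
    refine mem_globalSol_of_le hfstar hxfeas (le_of_tendsto_of_tendsto' hflim hubd fun n => ?_)
    linarith [hbd (φ n), hV0 (φ n), hη0 (φ n)]
  obtain ⟨ν₀, ψ, hψ, hνlim⟩ := (hnd x₀ hx₀).exists_subseq_multiplier hf hG hh
    (ν := fun n => ν (φ n)) (M := fstar - P.f z + 2 * α) hxlim (Eventually.of_forall fun n => by
      simp only [Function.comp_apply]
      linarith [hbd (φ n), hm (φ n), hV0 (φ n), hαc (φ n)])
  have hxlim' : Tendsto (fun n => x (φ (ψ n))) atTop (𝓝 x₀) := hxlim.comp hψ.tendsto_atTop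
  refine ⟨x₀, hx₀, ν₀, ?_, φ ∘ ψ, hφ.comp hψ, hxlim', hνlim⟩
  -- In the limit `f x₀ + η ≤ f*`, while `f x₀ = f*`.
  have h1 := (hflim.comp hψ.tendsto_atTop).add (tendsto_eta hf hG hh hxlim' hνlim)
  have h2 := le_of_tendsto_of_tendsto' h1 (hubd.comp hψ.tendsto_atTop) fun n => by
    simp only [Function.comp_apply]
    linarith [hbd (φ (ψ n)), hV0 (φ (ψ n))]
  rw [eq_of_mem_globalSol hfstar hx₀] at h2
  exact le_antisymm (by linarith) (eta_nonneg hf hG hh _ _)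

theorem exists_penalty_of_locallyExact (hf : ContDiff ℝ 1 P.f) (hG : ContDiff ℝ 1 P.G)
    (hh : ContDiff ℝ 1 P.h) (hα : 0 < α) (hκ : 1 ≤ κ)
    (hfstar : IsLeast (P.f '' P.feasible) fstar)
    (hnd : ∀ x ∈ P.globalSol, P.NondegenerateAt x)
    (hloc : ∀ x ∈ P.globalSol, Separating.LocallyExtendedlyExactAt (P.augLag α κ) P.eta x)
    (R : ℝ) : ∃ c₀ : ℝ, 0 < c₀ ∧ ∀ c, c₀ ≤ c → ∀ (x : EuclideanSpace ℝ (Fin d))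
      (ν : Multiplier l s), ‖x‖ ≤ R → (fstar : EReal) ≤ P.augLag α κ x ν c := by
  by_contra! hcon
  -- The shift by one keeps `c n ≥ 1`, so that `2α / c n` is uniformly bounded.
  choose c hc x ν hR hlt using fun n : ℕ => hcon ((n : ℝ) + 1) (by positivity)
  have hclim : Tendsto c atTop atTop := tendsto_atTop_mono
    (fun n => (le_add_of_nonneg_right zero_le_one).trans (hc n)) tendsto_natCast_atTop_atTop
  have hc1 : ∀ n, 1 ≤ c n := fun n =>
    (le_add_of_nonneg_left (Nat.cast_nonneg n)).trans (hc n)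
  obtain ⟨x₀, hx₀, ν₀, hη, φ, hφ, hxlim, hνlim⟩ :=
    exists_limit_of_augLag_lt hf hG hh hα hfstar hnd hc1 hclim hR hlt
  obtain ⟨c₁, hc₁, U, hU, hUle⟩ := hloc x₀ hx₀ ν₀ hη
  have hev := (hxlim.prodMk_nhds hνlim).eventually hU
  obtain ⟨n, hn, hcn⟩ := (hev.and
    ((hclim.comp hφ.tendsto_atTop).eventually_ge_atTop c₁)).exists
  have h1 := hUle _ hn _ hcn
  rw [augLag_eq_optimalValue hf hG hh hα hκ hfstar hx₀ (hnd x₀ hx₀) hη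
    (hc₁.trans_le hcn)] at h1
  exact (hlt (φ n)).not_ge h1

/-- The value `f*` is attained at optimal pairs, so the bound makes it the global minimum;
monotonicity carries the bound to larger `c`. -/
theorem globallyExtendedlyExact_iff (hf : ContDiff ℝ 1 P.f) (hG : ContDiff ℝ 1 P.G)
    (hh : ContDiff ℝ 1 P.h) (hα : 0 < α) (hκ : 1 ≤ κ)
    (hfstar : IsLeast (P.f '' P.feasible) fstar)
    (hnd : ∀ x ∈ P.globalSol, P.NondegenerateAt x) :
    Separating.GloballyExtendedlyExact P.globalSol (P.augLag α κ) P.eta ↔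
      ∃ c₀ : ℝ, 0 < c₀ ∧ ∀ x ν, (fstar : EReal) ≤ P.augLag α κ x ν c₀ := by
  obtain ⟨x₀, hx₀⟩ := globalSol_nonempty hfstar
  obtain ⟨ν₀, hη₀, -⟩ := exists_psd_multiplier hf hG hh hx₀ (hnd x₀ hx₀)
  have hval := fun {x} (hx : x ∈ P.globalSol) {ν : Multiplier l s} (hη : P.eta x ν = 0)
    {c : ℝ} (hc : 0 < c) => augLag_eq_optimalValue hf hG hh hα hκ hfstar hx (hnd x hx) hη hc
  constructor
  · rintro ⟨c₀, hc₀, hex⟩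
    refine ⟨c₀, hc₀, fun x ν => ?_⟩
    have := (hex c₀ le_rfl).2 x₀ hx₀ ν₀ hη₀ (x, ν)
    rwa [hval hx₀ hη₀ hc₀] at this
  · rintro ⟨c₀, hc₀, hle⟩
    -- A strict increase over `c₀` is needed: at a minimizer the value is `f*` for both parameters,
    -- so the gain vanishes, forcing `Y = 0` and `h x = 0`.
    refine ⟨c₀ + 1, by linarith, fun c hc => ⟨fun x ν hmin => ?_, fun x hx ν hη ζ => ?_⟩⟩
    · have h1 := hmin (x₀, ν₀)
      simp only at h1
      rw [hval hx₀ hη₀ (by linarith)] at h1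
      have h2 := hle x ν
      rcases P.augLag_cases (α := α) (κ := κ) x with ⟨ha, hb⟩ | htop
      · rw [augLag_eq ha hb, EReal.coe_le_coe_iff] at h1 h2
        obtain ⟨Y, hY, hYeq, hYle⟩ :=
          exists_augLagFinite_add_le (P := P) ν hc₀ (show c₀ ≤ c by linarith) ha
        have hp := (pFun_bounds ha ν.1).1
        have hq := (qFun_bounds hb ν.2).1
        have hcc : 0 < c - c₀ := by linarith
        have h3 : 0 ≤ (c - c₀) / (2 * P.pFun α κ x ν.1) * ‖Y‖ ^ 2 := by positivity
        have h4 : 0 ≤ (c - c₀) / (2 * P.qFun α x ν.2) * ‖P.h x‖ ^ 2 := by positivity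
        have h5 : (c - c₀) / (2 * P.pFun α κ x ν.1) * ‖Y‖ ^ 2 = 0 :=
          le_antisymm (by linarith) h3
        have h6 : (c - c₀) / (2 * P.qFun α x ν.2) * ‖P.h x‖ ^ 2 = 0 :=
          le_antisymm (by linarith) h4
        have hY0 : Y = 0 := by
          rcases mul_eq_zero.mp h5 with h | h
          · exact absurd h (by positivity)
          · exact norm_eq_zero.mp ((pow_eq_zero_iff two_ne_zero).mp h)
        have hh0 : P.h x = 0 := by
          rcases mul_eq_zero.mp h6 with h | h
          · exact absurd h (by positivity)
          · exact norm_eq_zero.mp ((pow_eq_zero_iff two_ne_zero).mp h)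
        subst hY0
        rw [sub_zero] at hY
        have hfeas : x ∈ P.feasible := ⟨hY, hh0⟩
        rw [hYeq, hh0, inner_zero_right, inner_zero_right, norm_zero, norm_zero] at h1
        have h7 := hfstar.2 ⟨x, hfeas, rfl⟩
        have h8 := eta_nonneg hf hG hh x ν
        exact ⟨le_antisymm (by linarith) h8, mem_globalSol_of_le hfstar hfeas (by linarith)⟩
      · rw [htop] at h1
        exact absurd h1 (by simp)
    · rw [hval hx hη (by linarith)]
      exact (hle ζ.1 ζ.2).trans (augLag_mono _ _ hc₀ (by linarith))

end SDProgram

end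

/-! ### The equivalence with local exactness -/

theorem theorem4 {d l s : ℕ} (P : SDProgram d l s)
    (hf : ContDiff ℝ 1 P.f) (hG : ContDiff ℝ 1 P.G) (hh : ContDiff ℝ 1 P.h)
    (α κ : ℝ) (hα : 0 < α) (hκ : 1 ≤ κ)
    -- a globally optimal solution exists, and `fstar` is the optimal value
    (fstar : ℝ) (hfstar : IsLeast (P.f '' P.feasible) fstar)
    (hnd : ∀ x ∈ P.globalSol, P.NondegenerateAt x) :
    (Separating.GloballyExtendedlyExact P.globalSol (P.augLag α κ) P.eta ↔
      (∀ x ∈ P.globalSol, Separating.LocallyExtendedlyExactAt (P.augLag α κ) P.eta x) ∧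
      (Separating.NonDegenerate (P.augLag α κ) ∨
        ∃ c₀ : ℝ, 0 < c₀ ∧ Bornology.IsBounded
          {ξ : EuclideanSpace ℝ (Fin d) × Multiplier l s |
            P.augLag α κ ξ.1 ξ.2 c₀ < (fstar : EReal)})) ∧
    ((∃ γ : ℝ, 0 < γ ∧ Bornology.IsBounded (P.omegaSet α κ fstar γ)) →
      (Separating.GloballyExtendedlyExact P.globalSol (P.augLag α κ) P.eta ↔
        ∀ x ∈ P.globalSol,
          Separating.LocallyExtendedlyExactAt (P.augLag α κ) P.eta x)) := by
  have hiff := SDProgram.globallyExtendedlyExact_iff hf hG hh hα hκ hfstar hnd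
  have hlocal : Separating.GloballyExtendedlyExact P.globalSol (P.augLag α κ) P.eta →
      ∀ x ∈ P.globalSol, Separating.LocallyExtendedlyExactAt (P.augLag α κ) P.eta x := by
    rintro ⟨c₀, hc₀, hex⟩ x hx ν hη
    exact ⟨c₀, hc₀, univ, univ_mem, fun ζ _ c hc => (hex c hc).2 x hx ν hη ζ⟩
  have hpen := SDProgram.exists_penalty_of_locallyExact hf hG hh hα hκ hfstar hnd
  refine ⟨⟨fun hex => ⟨hlocal hex, Or.inr ?_⟩, ?_⟩, fun hγ => ⟨hlocal, fun hloc => ?_⟩⟩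
  · obtain ⟨c₀, hc₀, hle⟩ := hiff.mp hex
    -- The sublevel set is empty for this parameter.
    refine ⟨c₀, hc₀, ?_⟩
    convert Bornology.isBounded_empty
    exact eq_empty_of_forall_notMem fun ξ hξ => (hle ξ.1 ξ.2).not_gt hξ
  · rintro ⟨hloc, ⟨c₀, hc₀, R, -, hmin⟩ | ⟨c₀, hc₀, hbdd⟩⟩
    · obtain ⟨c₁, hc₁, hle⟩ := hpen hloc R
      obtain ⟨x, ν, hxν, hR⟩ := hmin (max c₀ c₁) (le_max_left _ _)
      refine hiff.mpr ⟨max c₀ c₁, lt_max_of_lt_left hc₀, fun y ν' => ?_⟩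
      exact (hle _ (le_max_right _ _) x ν (by linarith [norm_nonneg ν])).trans (hxν (y, ν'))
    · obtain ⟨R, hR⟩ := hbdd.exists_norm_le
      obtain ⟨c₁, hc₁, hle⟩ := hpen hloc R
      refine hiff.mpr ⟨max c₀ c₁, lt_max_of_lt_left hc₀, fun x ν => ?_⟩
      by_contra! hlt
      -- By monotonicity the sublevel set shrinks as `c` grows, so it stays in the ball found for
      -- `c₀`.
      have hmem := (SDProgram.augLag_mono x ν hc₀ (le_max_left c₀ c₁)).trans_lt hlt
      exact hlt.not_ge (hle _ (le_max_right _ _) x ν ((norm_fst_le (x, ν)).trans (hR (x, ν) hmem)))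
  · obtain ⟨γ, hγ, hbdd⟩ := hγ
    obtain ⟨R, hR⟩ := hbdd.exists_norm_le
    obtain ⟨c₁, hc₁, hle⟩ := hpen hloc R
    have hc : 0 < max c₁ (2 * α / γ) := lt_max_of_lt_left hc₁
    -- The choice `c ≥ 2α / γ` makes the error `2α / c` at most `γ`, so points with value below `f*`
    -- have `x` in `Ω(α, γ)`.
    refine hiff.mpr ⟨max c₁ (2 * α / γ), hc, fun x ν => ?_⟩
    by_contra! hlt
    obtain ⟨ha, hb, hbd⟩ := SDProgram.bound_of_augLag_lt hc hlt
    refine hlt.not_ge (hle _ (le_max_left _ _) x ν (hR x ⟨?_, ha, hb⟩))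
    have h1 : 2 * α / max c₁ (2 * α / γ) ≤ γ := by
      rw [div_le_iff₀ hc, mul_comm γ, ← div_le_iff₀ hγ]
      exact le_max_right _ _
    have h2 : 0 ≤ max c₁ (2 * α / γ) / (4 * α) * P.violation x :=
      mul_nonneg (by positivity) (P.violation_nonneg x)
    linarith [SDProgram.eta_nonneg hf hG hh x ν]
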